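/- **Theorem (the amortized cost of ReNet can be a factor $\Theta(\log n)$ lower than the cost of Stat).** *Setting.* A demand on $n$ nodes is a finite sequence $\sigma=(\sigma_0,\dots,\sigma_{m-1})$ of requests $\sigma_t=(u,v)$. It is $(c,\delta)$-sparse if every contiguous subsequence of length at most $\delta$ contains at most $cn$ distinct pairs. For a degree bound $\Delta$, $\mathrm{Stat}_\Delta(\sigma)$ denotes the minimum, over all fixed networks $N$ on the $n$ nodes of maximum degree at most $\Delta$, of the average shortest-path length $\frac1m\sum_t d_N(\sigma_t)$. $\mathrm{ReNet}(\sigma)$ denotes the average cost per request of the self-adjusting network ReNet with threshold $\theta=4c$, started from the empty network. ReNet works as follows. - Every node keeps a working set of recent communication partners; it is small until its working set reaches size $\theta+1$, and large from then on. Two small partners are linked directly. A large node is linked to the root of an ego-tree, a splay tree whose keys are its partners; for two large partners a small helper node represents each of them in the ego-tree of the other. A node that becomes large stops being a helper and is replaced. - A request between known partners is routed over the direct link or through the ego-tree(s), and the accessed keys are splayed. A request between new partners first calls a coordinator, which adds each node to the other's working set and creates the connection (making nodes large if needed); if at that moment the working sets have total size at least $\theta n/2$, the coordinator first clears all working sets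 and links and makes all nodes small. - The cost of a request is its route length, plus the number of links added or removed, plus the lengths of the search paths of insertions and failed searches, plus $D$ for every message from or to the coordinator over the demand-oblivious network, plus $n$ for a reset. *Statement.* There is a constant $c\ge 1$ such that for every $D=D(n)=\Theta(\log n)$ there are constants $a,b>0$ such that, for every odd $s\ge 3$ and $n=s^2$, there is a demand $\sigma=\sigma^{(1)}\sigma^{(2)}\cdots\sigma^{(n)}$ on $n$ nodes with the following properties. 1. Each window $\sigma^{(i)}$ has length between $a\,n\log n$ and $b\,n\log n$; its demand graph is an $s\times s$ two-dimensional grid on all $n$ nodes (every grid edge being requested in both directions), and the $n$ demand graphs are pairwise different. 2. $\sigma$ is uniform: the requested pairs are exactly the ordered pairs $(u,v)$ with $u\ne v$, and all of them occur equally often in $\sigma$. 3. $\sigma$ is $(c,\delta)$-sparse for some $\delta\le|\sigma|$ with $\delta\ge c\,n\,D(n)$ and $\delta\ge a\,n\log n$. 4. While ReNet serves $\sigma$, its cost during each window $\sigma^{(i)}$ is at most $b\,|\sigma^{(i)}|$, and $\mathrm{ReNet}(\sigma)\le b$. 5. With $\Delta=6\theta=24c$: $\;a\log n\le \mathrm{Stat}_\Delta(\sigma)\le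 b\log n$, and $$a\log n\cdot \mathrm{ReNet}(\sigma)\;\le\;\mathrm{Stat}_\Delta(\sigma)\;\le\; b\log n\cdot \mathrm{ReNet}(\sigma).$$ -/

import Mathlib

open Filter Asymptotics
open scoped ENNReal

/-! ### Communication demands -/

/-- A communication request `(u, v)` from source `u` to destination `v` among `n` nodes. -/
abbrev Request (n : ℕ) : Type := Fin n × Fin n

/-- The (directed) edge set of the demand graph of a sequence of requests. -/
def demandEdges {n : ℕ} (σ : List (Request n)) : Finset (Request n) := σ.toFinset

/-- `(c, δ)`-sparse communication: every (contiguous) subsequence of length at most `δ` involves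
at most `c * n` distinct communication pairs. -/
def IsSparse {n : ℕ} (c δ : ℕ) (σ : List (Request n)) : Prop :=
  ∀ τ : List (Request n), τ <:+: σ → τ.length ≤ δ → (demandEdges τ).card ≤ c * n

/-- The two-dimensional `s × s` grid. -/
def grid (s : ℕ) : SimpleGraph (Fin s × Fin s) :=
  (SimpleGraph.pathGraph s).boxProd (SimpleGraph.pathGraph s)

/-- The demand graph of `σ` is, up to naming the nodes, the `s × s` grid spanning all nodes
(every grid edge being used in both directions). -/
def IsGridDemand {n : ℕ} (s : ℕ) (σ : List (Request n)) : Prop :=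
  ∃ e : Fin n ≃ Fin s × Fin s, ∀ u v : Fin n, (u, v) ∈ demandEdges σ ↔ (grid s).Adj (e u) (e v)

/-- Every source communicates with every other node, all ordered pairs having equal frequency. -/
def IsUniformDemand {n : ℕ} (σ : List (Request n)) : Prop :=
  (∀ u v : Fin n, (u, v) ∈ σ ↔ u ≠ v) ∧
    ∀ u v u' v' : Fin n, u ≠ v → u' ≠ v' → σ.count (u, v) = σ.count (u', v')

/-- The concatenation of `k` demands. -/
def concatDemand {n k : ℕ} (w : Fin k → List (Request n)) : List (Request n) :=
  (List.ofFn w).flatten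

/-- The requests before window `i` in the concatenation. -/
def demandBefore {n k : ℕ} (w : Fin k → List (Request n)) (i : Fin k) : List (Request n) :=
  ((List.ofFn w).take i).flatten

/-! ### Static networks -/

/-- The average route length when `σ` is served by the fixed network `N` along shortest paths
(infinite if some request cannot be routed). -/
noncomputable def staticRouteCost {n : ℕ} (N : SimpleGraph (Fin n)) (σ : List (Request n)) :
    ℝ≥0∞ :=
  (σ.map fun r => ((N.edist r.1 r.2 : ℕ∞) : ℝ≥0∞)).sum / (σ.length : ℝ≥0∞)

/-- `Stat`: the cost of an optimal static network of maximum degree at most `Δ`, chosen with full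
knowledge of `σ`. -/
noncomputable def statCost {n : ℕ} (Δ : ℕ) (σ : List (Request n)) : ℝ≥0∞ :=
  ⨅ N : {N : SimpleGraph (Fin n) // ∀ v, (N.neighborSet v).ncard ≤ Δ}, staticRouteCost N.1 σ

/-! ### Splay trees -/

namespace Splay

variable {α : Type*} [LinearOrder α]

/-- One level of the path from a tree node up to the root: `left p t` says that the node is the
left child of `p`, whose right subtree is `t`; symmetrically for `right p t`. -/
inductive Step (α : Type*) where
  | left (p : α) (sibling : BinaryTree α)
  | right (p : α) (sibling : BinaryTree α)

/-- Bottom-up splaying of the node `k` with subtrees `l`, `r` along the path to the root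
(the closest ancestor comes first): zig, zig-zig and zig-zag steps. -/
def splayUp (k : α) (l r : BinaryTree α) : List (Step α) → BinaryTree α
  | [] => .node k l r
  | [.left p t] => .node k l (.node p r t)
  | [.right p t] => .node k (.node p t l) r
  | .left p t :: .left g t' :: path => splayUp k l (.node p r (.node g t t')) path
  | .right p t :: .right g t' :: path => splayUp k (.node p (.node g t' t) l) r path
  | .left p t :: .right g t' :: path => splayUp k (.node g t' l) (.node p r t) path
  | .right p t :: .left g t' :: path => splayUp k (.node p t l) (.node g r t') path

/-- Search for `k` (inserting it as a leaf if it is absent) and splay it to the root. -/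
def accessAux (k : α) : BinaryTree α → List (Step α) → BinaryTree α
  | .nil, path => splayUp k .nil .nil path
  | .node a l r, path =>
      if k = a then splayUp k l r path
      else if k < a then accessAux k l (.left a r :: path)
      else accessAux k r (.right a l :: path)

/-- Splay-tree access: search for `k`, insert it if it is absent, and splay it to the root. -/
def access (k : α) (t : BinaryTree α) : BinaryTree α := accessAux k t []

/-- The number of tree nodes on the search path of `k`. If `k` is in the tree, this is the hop
distance between `k` and a node that is linked to the root from outside. -/
def searchLength (k : α) : BinaryTree α → ℕ
  | .nil => 0
  | .node a l r =>
      if k = a then 1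
      else if k < a then 1 + searchLength k l
      else 1 + searchLength k r

end Splay

/-! ### ReNet -/

namespace ReNet

/-- The state of a ReNet on `n` nodes. -/
structure State (n : ℕ) where
  /-- The working sets. -/
  workingSet : Fin n → Finset (Fin n)
  /-- The large nodes; all others are small. -/
  large : Finset (Fin n)
  /-- The ego-tree of each large node, whose keys are the communication partners. -/
  tree : Fin n → BinaryTree (Fin n)
  /-- The helper (relay) node of a pair of large nodes. -/
  helper : Fin n → Fin n → Option (Fin n)
  /-- The total cost incurred so far. -/
  cost : ℕ

variable {n : ℕ}

/-- The empty network. -/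
def init (n : ℕ) : State n where
  workingSet _ := ∅
  large := ∅
  tree _ := .nil
  helper _ _ := none
  cost := 0

/-- Add `x` to the incurred cost. -/
def State.pay (s : State n) (x : ℕ) : State n := { s with cost := s.cost + x }

/-- The physical node that stores the key `k` in the ego-tree of `w`: the node `k` itself if it is
small, and the helper of the pair if `k` is large. -/
def State.host (s : State n) (w k : Fin n) : Fin n :=
  if k ∈ s.large then (s.helper w k).getD k else k

/-- The physical links of a tree whose root is linked to the node `p`, for a given placement `h`
of the keys. -/
def treeLinks (h : Fin n → Fin n) (p : Fin n) : BinaryTree (Fin n) → Multiset (Sym2 (Fin n))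
  | .nil => 0
  | .node a l r => s(p, h a) ::ₘ (treeLinks h (h a) l + treeLinks h (h a) r)

/-- The direct links: small nodes are linked to the small nodes in their working set. -/
def State.directLinks (s : State n) : Multiset (Sym2 (Fin n)) :=
  ((Finset.univ : Finset (Fin n × Fin n)).filter fun p =>
    p.1 < p.2 ∧ p.1 ∉ s.large ∧ p.2 ∉ s.large ∧ p.2 ∈ s.workingSet p.1).val.map
      fun p => s(p.1, p.2)

/-- The physical network, a multigraph: the direct links and the links of the ego-trees of all
large nodes, each large node being linked to the root of its ego-tree. -/
def State.network (s : State n) : Multiset (Sym2 (Fin n)) :=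
  (s.directLinks + ∑ w ∈ s.large, treeLinks (s.host w) w (s.tree w)).filter fun e => ¬ e.IsDiag

/-- The number of link changes (removals and additions) between two networks. -/
def adj (N N' : Multiset (Sym2 (Fin n))) : ℕ := (N - N').card + (N' - N).card

/-- The number of large-large pairs that `x` currently helps. -/
def State.helpLoad (s : State n) (x : Fin n) : ℕ :=
  ((Finset.univ : Finset (Fin n × Fin n)).filter fun p =>
    p.1 < p.2 ∧ s.helper p.1 p.2 = some x).card

/-- The first available helper: a small node that still has room for one more pair (six ports)
in the half of its forwarding table of size `6 * θ` that is reserved for helping. -/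
def State.findHelper (θ : ℕ) (s : State n) : Option (Fin n) :=
  (List.finRange n).find? fun x => decide (x ∉ s.large ∧ 6 * (s.helpLoad x + 1) ≤ 3 * θ)

/-- Set the helper of the pair `a`, `b`. -/
def State.setHelper (s : State n) (a b : Fin n) (x : Option (Fin n)) : State n :=
  { s with helper := fun p q => if (p = a ∧ q = b) ∨ (p = b ∧ q = a) then x else s.helper p q }

/-- Assign a helper to the pair of large nodes `a`, `b` unless they already have one, at the cost
`D` of one message to the helper. -/
def State.assignHelper (D θ : ℕ) (s : State n) (a b : Fin n) : State n :=
  match s.helper a b with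
  | some _ => s
  | none => (s.setHelper a b (s.findHelper θ)).pay D

/-- Replace the tree of `w` by the one obtained by accessing (and, if necessary, inserting)
the key `k`. -/
def State.splay (s : State n) (w k : Fin n) : State n :=
  { s with tree := Function.update s.tree w (Splay.access k (s.tree w)) }

/-- `ego-BST(w).insert(k)`; the length of the search path is paid. -/
def State.insert (s : State n) (w k : Fin n) : State n :=
  (s.splay w k).pay (Splay.searchLength k (s.tree w))

/-- If `u` helps the pair `p`, find a replacement. -/
def State.replaceHelper (D θ : ℕ) (u : Fin n) (s : State n) (p : Fin n × Fin n) : State n :=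
  if s.helper p.1 p.2 = some u then (s.setHelper p.1 p.2 none).assignHelper D θ p.1 p.2 else s

/-- Connect the large node `u` to its partner `v` through its ego-tree (and that of `v`, by means
of a helper, if `v` is large as well). -/
def State.connectLarge (D θ : ℕ) (u : Fin n) (s : State n) (v : Fin n) : State n :=
  if v ∈ s.large then ((s.assignHelper D θ u v).insert u v).insert v u else s.insert u v

/-- `makeLarge(u)`: `u` becomes large and stops being a helper, and its ego-tree is created from
its working set. A message of cost `D` is sent to `u` and to each of its partners. -/
def State.makeLarge (D θ : ℕ) (s : State n) (u : Fin n) : State n :=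
  let s₁ : State n :=
    { s with large := Insert.insert u s.large, tree := Function.update s.tree u .nil }
  let s₂ := (s₁.pay D).pay (D * (s.workingSet u).card)
  let s₃ := (List.product (List.finRange n) (List.finRange n)).foldl (State.replaceHelper D θ u) s₂
  ((List.finRange n).filter fun v => decide (v ∈ s.workingSet u)).foldl
    (State.connectLarge D θ u) s₃

/-- `reset()`: all working sets and forwarding tables are cleared and all nodes become small, at
the cost `n` of a broadcast. -/
def State.reset (s : State n) : State n := { init n with cost := s.cost + n }

/-- Add `v` to the working set of `u`; if `u` is small and its working set has thereby reached
size `θ + 1`, then `u` becomes large. -/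
def State.addPartner (D θ : ℕ) (s : State n) (u v : Fin n) : State n :=
  let s₁ : State n :=
    { s with workingSet :=
        Function.update s.workingSet u (Insert.insert v (s.workingSet u)) }
  if u ∉ s₁.large ∧ (s₁.workingSet u).card = θ + 1 then s₁.makeLarge D θ u else s₁

/-- `addRoute(u → v)` of the coordinator: a notification from the source and messages to `u` and
`v` (cost `D` each); a reset if the working sets have total size `θ * n / 2`; then the new
connection. -/
def State.addRoute (D θ : ℕ) (s : State n) (u v : Fin n) : State n :=
  let s₀ := s.pay (3 * D)
  let s₁ := if θ * n ≤ 2 * ∑ x, (s₀.workingSet x).card then s₀.reset else s₀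
  let s₂ := (s₁.addPartner D θ u v).addPartner D θ v u
  if u ∈ s₂.large then s₂.connectLarge D θ u v
  else if v ∈ s₂.large then s₂.connectLarge D θ v u
  else s₂

/-- The length of the route from `u` to `v`: a direct link between small nodes; otherwise down the
ego-tree of `u` if `u` is large and up the ego-tree of `v` if `v` is large. -/
def State.routeLength (s : State n) (u v : Fin n) : ℕ :=
  if u ∉ s.large ∧ v ∉ s.large then 1
  else (if u ∈ s.large then Splay.searchLength v (s.tree u) else 0) +
    (if v ∈ s.large then Splay.searchLength u (s.tree v) else 0)

/-- `adjust()`: the splay operations in the ego-trees on which the request was routed. -/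
def State.adjust (s : State n) (u v : Fin n) : State n :=
  let s₁ := if u ∈ s.large then s.splay u v else s
  if v ∈ s.large then s₁.splay v u else s₁

/-- Serve one request. If `v` is not yet a partner of `u`, the coordinator is called first (a large
source also pays for the failed search in its ego-tree). The cost is the route length plus the
number of link changes plus the cost of the coordination. -/
def State.serve (D θ : ℕ) (s : State n) (q : Request n) : State n :=
  let u := q.1
  let v := q.2
  if u = v then s
  else
    let s₁ := if v ∈ s.workingSet u then s
      else (s.pay (if u ∈ s.large then Splay.searchLength v (s.tree u) else 0)).addRoute D θ u v
    let s₂ := s₁.adjust u v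
    s₂.pay (s₁.routeLength u v + adj s.network s₂.network)

/-- The state of ReNet with threshold `θ` after serving `σ`, starting from the empty network;
a message over the demand-oblivious network costs `D`. -/
def run (D θ : ℕ) (σ : List (Request n)) : State n := σ.foldl (State.serve D θ) (init n)

/-- The total cost of serving `σ`. -/
def totalCost (D θ : ℕ) (σ : List (Request n)) : ℕ := (run D θ σ).cost

/-- The (average) cost of ReNet on the demand `σ`, starting from the empty network. -/
noncomputable def avgCost (D θ : ℕ) (σ : List (Request n)) : ℝ≥0∞ :=
  (totalCost D θ σ : ℝ≥0∞) / (σ.length : ℝ≥0∞)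

end ReNet

/-! The demand has to look uniform globally, which is expensive for any static network, while each
window is a sparse grid that ReNet can wire directly.

Grids. Number the grid positions in row-major order and label position `p` by `(-1)^p (2p+1)` modulo
`n = s²`. Neighbours lie at the odd distance 1 or `s`, so their labels sum to one of the four values
±2, ±2s. Window `i` adds `2(s+1)i` to every label, hence `4(s+1)i` to every sum. Both factors are
units modulo `s²`. For a fixed pair of nodes the sum is fixed, so at most four windows contain the
pair; `exists_adj_gridLabel` realizes every difference of labels along an edge, so at least one
does. `exists_grid_family` collects this, together with the disjointness of windows at distance at
most 4 when `s ≥ 7`. Requesting a pair that lies in `m ≤ 4` grids `12K/m` times in each of them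
makes the concatenation uniform.

ReNet. With `θ = 32` no node ever becomes large. Five consecutive grids are disjoint and hold at
least `16n = θn/2` pairs, so soon after that many windows a new pair triggers a reset. Hence a node
knows at most `4·6 = 24` partners between windows, and at most 28 within one (`Calm.window`). A
window sees at most one reset and `8n + 1` coordinator calls, costing `O(nD + n)`. Its length is at
least `8nK` with `K > 8D`, so the cost per request is at most 7 (`run_windows`).

Static networks. On a uniform demand the cost is essentially the mean distance. Balls of radius `k`
have at most `(Δ+1)^k` nodes, so half of the nodes are logarithmically far (`le_statCost`); a binary
tree attains this order (`statCost_le`). -/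

/-! ### A family of grids covering the complete graph -/

/-- The alternating labelling `1, -3, 5, -7, …` of the positions `0, 1, 2, …`. -/
def zigzag (n p : ℕ) : ZMod n := (-1) ^ p * (2 * p + 1)

theorem zigzag_of_even {n p : ℕ} (h : Even p) : zigzag n p = 2 * p + 1 := by
  simp [zigzag, h.neg_one_pow]

theorem zigzag_of_odd {n p : ℕ} (h : Odd p) : zigzag n p = -(2 * p + 1) := by
  simp only [zigzag, h.neg_one_pow]; ring

/-- At odd distance the signs are opposite, so the terms in `p` cancel and only `k` survives. This
is used for `k = 1` and `k = s`, the distances of grid neighbours. -/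
theorem zigzag_add_odd (n p : ℕ) {k : ℕ} (hk : Odd k) :
    zigzag n p + zigzag n (p + k) = 2 * k ∨ zigzag n p + zigzag n (p + k) = -(2 * k) := by
  rcases Nat.even_or_odd p with h | h
  · right
    rw [zigzag_of_even h, zigzag_of_odd (h.add_odd hk)]; push_cast; ring
  · left
    rw [zigzag_of_odd h, zigzag_of_even (h.add_odd hk)]; push_cast; ring

theorem zigzag_sub_of_odd (n : ℕ) {p k : ℕ} (hp : Odd p) (hk : Odd k) :
    zigzag n (p + k) - zigzag n p = 4 * p + 2 * k + 2 := by
  rw [zigzag_of_odd hp, zigzag_of_even (hp.add_odd hk)]; push_cast; ring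

/-- Equal parities give `n ∣ p - q`. Opposite parities give `n ∣ p + q + 1`, an even number strictly
between 0 and `2n`, which would have to be the odd number `n`. -/
theorem zigzag_injOn {n : ℕ} (hn : Odd n) {p q : ℕ} (hp : p < n) (hq : q < n)
    (h : zigzag n p = zigzag n q) : p = q := by
  have hcop : IsCoprime (n : ℤ) 2 := by
    rw [Int.isCoprime_iff_gcd_eq_one]
    exact_mod_cast Nat.Coprime.symm (Nat.coprime_two_left.2 hn)
  have same : ∀ k : ℤ, ((2 * k : ℤ) : ZMod n) = 0 → (n : ℤ) ∣ k := fun k hk =>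
    hcop.dvd_of_dvd_mul_left ((ZMod.intCast_zmod_eq_zero_iff_dvd _ _).1 hk)
  rcases Nat.even_or_odd p with h1 | h1 <;> rcases Nat.even_or_odd q with h2 | h2
  · rw [zigzag_of_even h1, zigzag_of_even h2] at h
    obtain ⟨k, hk⟩ := same (p - q) (by push_cast; linear_combination h)
    have := Int.eq_zero_of_abs_lt_dvd ⟨k, hk⟩ (by rw [abs_lt]; constructor <;> omega)
    omega
  · rw [zigzag_of_even h1, zigzag_of_odd h2] at h
    obtain ⟨k, hk⟩ := same (p + q + 1) (by push_cast; linear_combination h)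
    have hk1 : 0 < k := by by_contra hc; nlinarith
    have hk2 : k < 2 := by by_contra hc; nlinarith
    obtain rfl : k = 1 := by omega
    obtain ⟨a, rfl⟩ := h1; obtain ⟨b, rfl⟩ := h2; obtain ⟨m, rfl⟩ := hn
    omega
  · rw [zigzag_of_odd h1, zigzag_of_even h2] at h
    obtain ⟨k, hk⟩ := same (p + q + 1) (by push_cast; linear_combination -h)
    have hk1 : 0 < k := by by_contra hc; nlinarith
    have hk2 : k < 2 := by by_contra hc; nlinarith
    obtain rfl : k = 1 := by omega
    obtain ⟨a, rfl⟩ := h1; obtain ⟨b, rfl⟩ := h2; obtain ⟨m, rfl⟩ := hn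
    omega
  · rw [zigzag_of_odd h1, zigzag_of_odd h2] at h
    obtain ⟨k, hk⟩ := same (p - q) (by push_cast; linear_combination -h)
    have := Int.eq_zero_of_abs_lt_dvd ⟨k, hk⟩ (by rw [abs_lt]; constructor <;> omega)
    omega

/-- The possible sums of the labels of two adjacent grid positions. -/
def adjacentSums (s n : ℕ) : Finset (ZMod n) := {2, -2, 2 * (s : ZMod n), -(2 * (s : ZMod n))}

/-- The label of a grid position, shifted by a multiple of `2 * (s + 1)`. -/
def gridLabel {s : ℕ} (n i : ℕ) (x : Fin s × Fin s) : ZMod n :=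
  zigzag n (x.1 * s + x.2) + 2 * (s + 1) * i

theorem gridLabel_add_mem {s n : ℕ} (hs : Odd s) (i : ℕ) {x y : Fin s × Fin s}
    (h : (grid s).Adj x y) :
    (gridLabel n i x + gridLabel n i y - 4 * (s + 1) * i : ZMod n) ∈ adjacentSums s n := by
  have key : ∀ x y : Fin s × Fin s, (x.1 : ℕ) + 1 = y.1 ∧ x.2 = y.2 ∨
      (x.2 : ℕ) + 1 = y.2 ∧ x.1 = y.1 →
      zigzag n (x.1 * s + x.2) + zigzag n (y.1 * s + y.2) ∈ adjacentSums s n := by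
    rintro ⟨a, b⟩ ⟨c, d⟩ (⟨h1, h2⟩ | ⟨h1, h2⟩)
    · simp only at h1 h2
      subst h2
      have : (c : ℕ) * s + b = (a * s + b) + s := by rw [← h1]; ring
      simp only [this]
      rcases zigzag_add_odd n (a * s + b) hs with h | h <;> simp [adjacentSums, h]
    · simp only at h1 h2
      subst h2
      have : (a : ℕ) * s + d = (a * s + b) + 1 := by rw [← h1]; ring
      simp only [this]
      rcases zigzag_add_odd n (a * s + b) odd_one with h | h <;> simp [adjacentSums, h]
  have hsum : (gridLabel n i x + gridLabel n i y - 4 * (s + 1) * i : ZMod n) =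
      zigzag n (x.1 * s + x.2) + zigzag n (y.1 * s + y.2) := by
    simp only [gridLabel]; ring
  rw [hsum]
  simp only [grid, SimpleGraph.boxProd_adj, SimpleGraph.pathGraph_adj] at h
  rcases h with ⟨h1 | h1, h2⟩ | ⟨h1 | h1, h2⟩
  · exact key x y (.inl ⟨h1, h2⟩)
  · rw [add_comm]; exact key y x (.inl ⟨h1, h2.symm⟩)
  · exact key x y (.inr ⟨h1, h2⟩)
  · rw [add_comm]; exact key y x (.inr ⟨h1, h2.symm⟩)

theorem gridLabel_injective {s n : ℕ} (hs : Odd s) (hn : n = s ^ 2) (i : ℕ) :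
    Function.Injective (gridLabel n i : Fin s × Fin s → ZMod n) := by
  rintro ⟨a, b⟩ ⟨c, d⟩ h
  have hlt : ∀ a b : Fin s, (a : ℕ) * s + b < n := by
    intro a b
    have h1 := a.2
    have h2 := b.2
    rw [hn]; nlinarith
  have h0 := zigzag_injOn (by rw [hn]; exact hs.pow) (hlt a b) (hlt c d)
    (add_right_cancel h)
  have hs0 : 0 < s := hs.pos
  have e1 : (a : ℕ) = c := by
    have := congrArg (· / s) h0
    simpa [Nat.add_div_of_dvd_right, Nat.mul_div_cancel _ hs0, Nat.div_eq_of_lt] using this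
  have e2 : (b : ℕ) = d := by rw [e1] at h0; omega
  exact Prod.ext (Fin.ext e1) (Fin.ext e2)

/-- Divisibility forces `s ∣ 2l - b`. This number is 0 only for `l = 1`, `b = 2`, and otherwise lies
between `s` and 10, which leaves `s = 7` and `s = 9`. Parity matters there: `a = 0`, `b = -1`, `s =
2l + 1` would give exactly `s²`. -/
theorem not_dvd_grid_shift {s a b l : ℤ} (hs : 7 ≤ s) (hodd : Odd s) (hl : 1 ≤ l) (hl' : l ≤ 4)
    (hab : |a| + |b| ≤ 2) (hpar : Even (a + b)) : ¬ s ^ 2 ∣ (2 * l - a) * s + (2 * l - b) := by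
  intro h
  have hb := abs_le.1 (le_trans (le_add_of_nonneg_left (abs_nonneg a)) hab)
  have ha := abs_le.1 (le_trans (le_add_of_nonneg_right (abs_nonneg b)) hab)
  have h1 : s ∣ 2 * l - b := by
    have : s ∣ (2 * l - a) * s + (2 * l - b) := (Dvd.intro _ (sq s).symm).trans h
    exact (dvd_add_right (Dvd.intro_left _ rfl)).1 this
  rcases eq_or_ne (2 * l - b) 0 with h0 | h0
  · rw [h0, add_zero, sq] at h
    have h2 : s ∣ 2 * l - a := (mul_dvd_mul_iff_right (by omega)).1 h
    have hb2 : b = 2 := by omega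
    have ha2 : a = 0 := by
      rw [hb2] at hab
      have : |a| ≤ 0 := by norm_num at hab ⊢; simpa using hab
      simpa using this
    have := Int.le_of_dvd (by omega) h2
    omega
  · have h2 := Int.le_of_dvd (by omega) h1
    obtain ⟨m, hm⟩ := hodd
    obtain ⟨m', hm'⟩ := hpar
    have hs79 : s = 7 ∨ s = 9 := by omega
    have : |a| ≤ 2 - |b| := by linarith
    rcases hs79 with rfl | rfl
    · rcases abs_cases a with ha' | ha' <;> rcases abs_cases b with hb' | hb' <;>
        interval_cases l <;> omega
    · rcases abs_cases a with ha' | ha' <;> rcases abs_cases b with hb' | hb' <;>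
        interval_cases l <;> omega

/-- An edge from an odd position `p` to `p + k` has label difference `4p + 2k + 2`. Writing `v - u =
4d` determines `p` from `d`, and `p` has the right parity for either `d` or `n - d`: `n` is odd, so
exchanging `u` and `v` flips the parity, and `s ∣ n` keeps the case distinction `s ∣ d` intact. -/
theorem exists_adj_gridLabel {s n : ℕ} (hs : Odd s) (hn : n = s ^ 2) {u v : ZMod n} (huv : u ≠ v) :
    ∃ (x y : Fin s × Fin s) (τ : ZMod n), (grid s).Adj x y ∧
      zigzag n (x.1 * s + x.2) + τ = u ∧ zigzag n (y.1 * s + y.2) + τ = v := by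
  have hs0 : 0 < s := hs.pos
  have hn0 : n ≠ 0 := by rw [hn]; positivity
  have : NeZero n := ⟨hn0⟩
  have hnodd : Odd n := by rw [hn]; exact hs.pow
  have h4 : IsUnit ((4 : ℕ) : ZMod n) := by
    rw [ZMod.isUnit_iff_coprime]
    exact Nat.Coprime.pow_left 2 (Nat.coprime_two_left.2 hnodd)
  -- positions and coordinates
  have coord : ∀ p, p < n → ∃ x : Fin s × Fin s, (x.1 : ℕ) * s + x.2 = p := fun p hp =>
    ⟨(⟨p / s, by rw [Nat.div_lt_iff_lt_mul hs0, ← sq, ← hn]; exact hp⟩, ⟨p % s, Nat.mod_lt _ hs0⟩),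
      by simpa [mul_comm] using Nat.div_add_mod p s⟩
  -- a suitable odd position realizes every difference of the right parity
  have build : ∀ (u v : ZMod n) (p k : ℕ), Odd p → Odd k → p + k < n →
      v - u = 4 * p + 2 * k + 2 →
      (∀ x y : Fin s × Fin s, (x.1 : ℕ) * s + x.2 = p → (y.1 : ℕ) * s + y.2 = p + k →
        (grid s).Adj x y) →
      ∃ (x y : Fin s × Fin s) (τ : ZMod n), (grid s).Adj x y ∧
        zigzag n (x.1 * s + x.2) + τ = u ∧ zigzag n (y.1 * s + y.2) + τ = v := by
    intro u v p k hp hk hpk hd hadj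
    obtain ⟨x, hx⟩ := coord p (by omega)
    obtain ⟨y, hy⟩ := coord (p + k) hpk
    refine ⟨x, y, u - zigzag n p, hadj x y hx hy, ?_, ?_⟩
    · rw [hx]; ring
    · rw [hy]; linear_combination zigzag_sub_of_odd n hp hk - hd
  have horiz : ∀ p, ¬ s ∣ p + 1 → ∀ x y : Fin s × Fin s,
      (x.1 : ℕ) * s + x.2 = p → (y.1 : ℕ) * s + y.2 = p + 1 → (grid s).Adj x y := by
    intro p hp x y hx hy
    have hx2 := x.2.2
    have hy2 := y.2.2
    have h1 : (x.2 : ℕ) + 1 < s := by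
      by_contra hc
      exact hp ⟨x.1 + 1, by rw [← hx, mul_add, mul_one, mul_comm s]; omega⟩
    have e : (y.1 : ℕ) * s + y.2 = x.1 * s + (x.2 + 1) := by omega
    have e1 : (y.1 : ℕ) = x.1 := by
      have := congrArg (· / s) e
      simpa [Nat.add_div_of_dvd_right, Nat.mul_div_cancel _ hs0, Nat.div_eq_of_lt hy2,
        Nat.div_eq_of_lt h1] using this
    rw [e1] at e
    simp only [grid, SimpleGraph.boxProd_adj, SimpleGraph.pathGraph_adj]
    exact .inr ⟨.inl (by omega), Fin.ext e1.symm⟩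
  have vert : ∀ p, ∀ x y : Fin s × Fin s,
      (x.1 : ℕ) * s + x.2 = p → (y.1 : ℕ) * s + y.2 = p + s → (grid s).Adj x y := by
    intro p x y hx hy
    have e : (y.1 : ℕ) * s + y.2 = (x.1 + 1) * s + x.2 := by rw [hy, ← hx]; ring
    have e1 : (y.1 : ℕ) = x.1 + 1 := by
      have := congrArg (· / s) e
      simpa [Nat.add_div_of_dvd_right, Nat.mul_div_cancel _ hs0, Nat.div_eq_of_lt x.2.2,
        Nat.div_eq_of_lt y.2.2] using this
    rw [e1] at e
    simp only [grid, SimpleGraph.boxProd_adj, SimpleGraph.pathGraph_adj]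
    exact .inl ⟨.inl e1.symm, Fin.ext (by omega)⟩
  -- up to exchanging `u` and `v`, the parity is right
  have half : ∀ (u v : ZMod n) (d : ℕ), 0 < d → d < n → (4 * d : ZMod n) = v - u →
      (if s ∣ d then Odd (d + (s + 1) / 2) else Even d) →
      ∃ (x y : Fin s × Fin s) (τ : ZMod n), (grid s).Adj x y ∧
        zigzag n (x.1 * s + x.2) + τ = u ∧ zigzag n (y.1 * s + y.2) + τ = v := by
    intro u v d hd0 hdn hd hpar
    -- Solving `4p + 2k + 2 = 4d` gives `p = d - 1` for a horizontal edge and `p = d - (s+1)/2` for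
    -- a vertical one. The vertical edge serves the case `s ∣ d`, where position `d` starts a new
    -- row and is not adjacent to `d - 1`.
    split_ifs at hpar with hsd
    · obtain ⟨m, hm⟩ := hs
      have hm' : (s + 1) / 2 = m + 1 := by omega
      rw [hm'] at hpar
      have hsd' := Nat.le_of_dvd hd0 hsd
      have hds : d + s ≤ n := by
        obtain ⟨q, rfl⟩ := hsd
        rw [hn, sq] at hdn ⊢
        have := Nat.lt_of_mul_lt_mul_left hdn
        nlinarith
      refine build u v (d - (m + 1)) s ?_ ⟨m, hm⟩ (by omega) ?_ (vert _)
      · obtain ⟨r, hr⟩ := hpar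
        exact ⟨r - (m + 1), by omega⟩
      · rw [← hd, Nat.cast_sub (by omega), hm]; push_cast; ring
    · obtain ⟨r, hr⟩ := hpar
      refine build u v (d - 1) 1 ⟨r - 1, by omega⟩ odd_one (by omega) ?_ (horiz _ ?_)
      · rw [← hd, Nat.cast_sub (by omega)]; push_cast; ring
      · rwa [Nat.sub_add_cancel hd0]
  obtain ⟨c, hc⟩ := h4
  set d := ((↑c⁻¹ : ZMod n) * (v - u)).val with hd
  have hd4 : (4 * d : ZMod n) = v - u := by
    rw [hd, ZMod.natCast_zmod_val]
    have : (4 : ZMod n) = c := by rw [hc]; norm_num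
    rw [this, Units.mul_inv_cancel_left]
  have hdn : d < n := ZMod.val_lt _
  have hd0 : 0 < d := by
    rcases Nat.eq_zero_or_pos d with h | h
    · rw [h, Nat.cast_zero, mul_zero] at hd4
      exact absurd (sub_eq_zero.1 hd4.symm).symm huv
    · exact h
  have hdvd : s ∣ n - d ↔ s ∣ d := by
    have : s ∣ n := ⟨s, by rw [hn, sq]⟩
    exact Nat.dvd_sub_iff_right hdn.le this
  by_cases hp : if s ∣ d then Odd (d + (s + 1) / 2) else Even d
  · exact half u v d hd0 hdn hd4 hp
  · obtain ⟨x, y, τ, h1, h2, h3⟩ := half v u (n - d) (by omega) (by omega)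
      (by rw [Nat.cast_sub hdn.le, ZMod.natCast_self]; linear_combination -hd4) (by
        simp only [hdvd]
        obtain ⟨m, hm⟩ := hnodd
        split_ifs at hp ⊢ with hsd
        · rw [Nat.not_odd_iff_even] at hp
          obtain ⟨r, hr⟩ := hp
          rw [Nat.odd_iff]; omega
        · rw [Nat.not_even_iff_odd] at hp
          obtain ⟨r, hr⟩ := hp
          rw [Nat.even_iff]; omega)
    exact ⟨y, x, τ, h1.symm, h3, h2⟩

/-- Translation by `t` permutes the set, so comparing the sums of its elements gives `4t = 0`, and 4
is a unit modulo the odd `n`. This makes different windows have different grids. -/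
theorem eq_zero_of_adjacentSums_shift {s n : ℕ} (h3 : 3 ≤ s) (hs : Odd s) (hn : n = s ^ 2) {t : ZMod n}
    (h : ∀ a ∈ adjacentSums s n, a + t ∈ adjacentSums s n) : t = 0 := by
  have hnodd : Odd n := by rw [hn]; exact hs.pow
  have h4 : IsUnit ((4 : ℕ) : ZMod n) := by
    rw [ZMod.isUnit_iff_coprime]
    exact Nat.Coprime.pow_left 2 (Nat.coprime_two_left.2 hnodd)
  have himg : (adjacentSums s n).image (· + t) = adjacentSums s n :=
    Finset.eq_of_subset_of_card_le (Finset.image_subset_iff.2 h)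
      (Finset.card_image_of_injective _ (add_left_injective t)).ge
  have hsum := congrArg (fun T => ∑ a ∈ T, a) himg
  rw [Finset.sum_image fun a _ b _ hab => add_left_injective t hab, Finset.sum_add_distrib,
    Finset.sum_const, add_eq_left] at hsum
  have hne : ∀ k : ℤ, k ≠ 0 → |k| < n → (k : ZMod n) ≠ 0 := fun k hk hkn h0 =>
    hk (Int.eq_zero_of_abs_lt_dvd ((ZMod.intCast_zmod_eq_zero_iff_dvd _ _).1 h0) hkn)
  have hne2 : ∀ k : ℤ, k ≠ 0 → |k| < n → ((2 * k : ℤ) : ZMod n) ≠ 0 := by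
    intro k hk hkn h0
    rw [ZMod.intCast_zmod_eq_zero_iff_dvd] at h0
    refine hk (Int.eq_zero_of_abs_lt_dvd (IsCoprime.dvd_of_dvd_mul_left ?_ h0) hkn)
    rw [Int.isCoprime_iff_gcd_eq_one]
    exact_mod_cast Nat.Coprime.symm (Nat.coprime_two_left.2 hnodd)
  have hns : (3 * s : ℤ) ≤ n := by rw [hn]; push_cast; nlinarith
  have hcard : (adjacentSums s n).card = 4 := by
    have hlt : ∀ k : ℤ, -(3 * s : ℤ) < k → k < 3 * s → |k| < n := fun k h1 h2 =>
      abs_lt.2 ⟨by omega, by omega⟩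
    have a1 := hne2 2 (by norm_num) (hlt _ (by omega) (by omega))
    have a2 := hne2 (1 - s) (by omega) (hlt _ (by omega) (by omega))
    have a3 := hne2 (1 + s) (by omega) (hlt _ (by omega) (by omega))
    have a4 := hne2 (2 * s) (by omega) (hlt _ (by omega) (by omega))
    push_cast at a1 a2 a3 a4
    rw [adjacentSums, Finset.card_insert_of_notMem, Finset.card_insert_of_notMem,
      Finset.card_insert_of_notMem, Finset.card_singleton]
    · simp only [Finset.mem_singleton]
      exact fun h => a4 (by linear_combination h)
    · simp only [Finset.mem_insert, Finset.mem_singleton]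
      rintro (h | h)
      · exact a3 (by linear_combination -h)
      · exact a2 (by linear_combination -h)
    · simp only [Finset.mem_insert, Finset.mem_singleton]
      rintro (h | h | h)
      · exact a1 (by linear_combination h)
      · exact a2 (by linear_combination h)
      · exact a3 (by linear_combination h)
  rw [hcard, nsmul_eq_mul] at hsum
  exact (h4.mul_right_eq_zero).1 hsum

/-- Consequently every translation of the labels is the shift of exactly one window. -/
theorem isUnit_gridShift {s n : ℕ} (hs : Odd s) (hn : n = s ^ 2) :
    IsUnit (2 * (s + 1) : ZMod n) := by
  have : IsUnit ((2 * (s + 1) : ℕ) : ZMod n) := by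
    rw [ZMod.isUnit_iff_coprime, hn]
    refine Nat.Coprime.pow_right 2 (Nat.Coprime.mul_left (Nat.coprime_two_left.2 hs) ?_)
    simp
  exact_mod_cast this

/-- Each admissible sum is `2(as + b)` with `|a| + |b| = 1`. A common edge would equate two of them
up to the shift `4(s+1)(j-i)`; halving yields the divisibility excluded by `not_dvd_grid_shift` with
`l = j - i`. -/
theorem gridLabel_windows_disjoint {s n i j : ℕ} (hs : Odd s) (h7 : 7 ≤ s) (hn : n = s ^ 2)
    (hij : i < j) (hji : j ≤ i + 4) {z : ZMod n}
    (hi : z - 4 * (s + 1) * i ∈ adjacentSums s n) (hj : z - 4 * (s + 1) * j ∈ adjacentSums s n) :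
    False := by
  have rep : ∀ t ∈ adjacentSums s n, ∃ a b : ℤ, |a| + |b| = 1 ∧ t = 2 * (a * s + b) := by
    intro t ht
    simp only [adjacentSums, Finset.mem_insert, Finset.mem_singleton] at ht
    rcases ht with rfl | rfl | rfl | rfl
    · exact ⟨0, 1, by norm_num, by push_cast; ring⟩
    · exact ⟨0, -1, by norm_num, by push_cast; ring⟩
    · exact ⟨1, 0, by norm_num, by push_cast; ring⟩
    · exact ⟨-1, 0, by norm_num, by push_cast; ring⟩
  obtain ⟨a, b, hab, ht⟩ := rep _ hi
  obtain ⟨a', b', hab', ht'⟩ := rep _ hj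
  have hcop : IsCoprime (n : ℤ) 2 := by
    rw [Int.isCoprime_iff_gcd_eq_one, hn]
    exact_mod_cast Nat.Coprime.symm (Nat.coprime_two_left.2 hs.pow)
  have hz : ((2 * ((2 * (j - i : ℤ) - (a - a')) * s + (2 * (j - i : ℤ) - (b - b'))) : ℤ)
      : ZMod n) = 0 := by
    push_cast
    linear_combination ht - ht'
  rw [ZMod.intCast_zmod_eq_zero_iff_dvd] at hz
  have hdvd := hcop.dvd_of_dvd_mul_left hz
  rw [hn, Nat.cast_pow] at hdvd
  have hpar : Even (a - a' + (b - b')) := by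
    rw [Int.even_iff]
    rcases abs_cases a with h | h <;> rcases abs_cases b with h' | h' <;>
      rcases abs_cases a' with h'' | h'' <;> rcases abs_cases b' with h''' | h''' <;> omega
  refine not_dvd_grid_shift (by omega) (by exact_mod_cast hs) (by omega) (by omega) ?_ hpar hdvd
  have := abs_sub a a'
  have := abs_sub b b'
  omega

/-- For odd `s`, there are `s ^ 2` different `s × s` grids on `s ^ 2` nodes that cover every pair
between one and four times; grids that follow each other closely have no common edge. -/
theorem exists_grid_family {s n : ℕ} (hs : Odd s) (h3 : 3 ≤ s) (hn : n = s ^ 2) :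
    ∃ e : Fin n → (Fin n ≃ Fin s × Fin s),
      (∀ u v, u ≠ v → ∃ i, (grid s).Adj (e i u) (e i v)) ∧
      (∀ (u v : Fin n) (S : Finset (Fin n)), (∀ i ∈ S, (grid s).Adj (e i u) (e i v)) →
        S.card ≤ 4) ∧
      (∀ i j, (∀ u v, (grid s).Adj (e i u) (e i v) ↔ (grid s).Adj (e j u) (e j v)) → i = j) ∧
      (7 ≤ s → ∀ i j : Fin n, i < j → (j : ℕ) ≤ i + 4 → ∀ u v, (grid s).Adj (e i u) (e i v) →
        ¬ (grid s).Adj (e j u) (e j v)) := by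
  have hn0 : n ≠ 0 := by rw [hn]; positivity
  have : NeZero n := ⟨hn0⟩
  have hbij : ∀ i : Fin n, Function.Bijective (gridLabel n i : Fin s × Fin s → ZMod n) := by
    intro i
    rw [Fintype.bijective_iff_injective_and_card]
    exact ⟨gridLabel_injective hs hn i, by rw [ZMod.card, hn]; simp [sq]⟩
  set ε : Fin n ≃ ZMod n := (ZMod.finEquiv n).toEquiv
  set g : Fin n → (Fin s × Fin s ≃ ZMod n) := fun i => Equiv.ofBijective _ (hbij i)
  have hg : ∀ i x, g i x = gridLabel n i x := fun i x => rfl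
  have hlabel : ∀ (i : Fin n) u, gridLabel n i ((ε.trans (g i).symm) u) = ε u := fun i u => by
    rw [← hg]; simp
  have hunit := isUnit_gridShift hs hn
  have hnodd : Odd n := by rw [hn]; exact hs.pow
  have hunit2 : IsUnit (4 * (s + 1) : ZMod n) := by
    have h2 : IsUnit ((2 : ℕ) : ZMod n) := by
      rw [ZMod.isUnit_iff_coprime]; exact Nat.coprime_two_left.2 hnodd
    have h := h2.mul hunit
    have e : ((2 : ℕ) : ZMod n) * (2 * (s + 1)) = 4 * (s + 1) := by push_cast; ring
    rwa [e] at h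
  have hcast : Function.Injective fun i : Fin n => ((i : ℕ) : ZMod n) := by
    intro i j hij
    have := (ZMod.natCast_eq_natCast_iff' _ _ _).1 hij
    rw [Nat.mod_eq_of_lt i.2, Nat.mod_eq_of_lt j.2] at this
    exact Fin.ext this
  have hmem : ∀ i u v, (grid s).Adj ((ε.trans (g i).symm) u) ((ε.trans (g i).symm) v) →
      ε u + ε v - 4 * (s + 1) * (i : ℕ) ∈ adjacentSums s n := by
    intro i u v h
    have := gridLabel_add_mem (n := n) hs i h
    rwa [hlabel, hlabel] at this
  refine ⟨fun i => ε.trans (g i).symm, ?_, ?_, ?_, ?_⟩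
  · intro u v huv
    obtain ⟨x, y, τ, hxy, hx, hy⟩ := exists_adj_gridLabel hs hn (ε.injective.ne huv)
    obtain ⟨c, hc⟩ := hunit
    refine ⟨⟨((↑c⁻¹ : ZMod n) * τ).val, ZMod.val_lt _⟩, ?_⟩
    have key : ∀ (x : Fin s × Fin s) u, zigzag n (x.1 * s + x.2) + τ = ε u →
        (ε.trans (g ⟨((↑c⁻¹ : ZMod n) * τ).val, ZMod.val_lt _⟩).symm) u = x := by
      intro x u hx
      rw [Equiv.trans_apply, Equiv.symm_apply_eq, hg, gridLabel, ← hx]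
      simp only [ZMod.natCast_val, ZMod.cast_id', id_eq]
      rw [← hc, Units.mul_inv_cancel_left]
    rw [key x u hx, key y v hy]
    exact hxy
  · intro u v S hS
    calc S.card ≤ (adjacentSums s n).card := by
          refine Finset.card_le_card_of_injOn (fun i => ε u + ε v - 4 * (s + 1) * (i : ℕ))
            (fun i hi => hmem i u v (hS i hi)) fun i _ j _ hij => hcast ?_
          exact hunit2.mul_left_cancel (sub_right_injective hij)
      _ ≤ 4 := Finset.card_le_four
  · intro i j hij
    have h0 : (4 * (s + 1) * (i : ℕ) - 4 * (s + 1) * (j : ℕ) : ZMod n) = 0 := by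
      refine eq_zero_of_adjacentSums_shift h3 hs hn fun a ha => ?_
      have hzero : ∃ u v, (grid s).Adj ((ε.trans (g i).symm) u) ((ε.trans (g i).symm) v) ∧
          ε u + ε v - 4 * (s + 1) * (i : ℕ) = a := by
        have mk : ∀ x y : Fin s × Fin s, (grid s).Adj x y →
            zigzag n (x.1 * s + x.2) + zigzag n (y.1 * s + y.2) = a →
            ∃ u v, (grid s).Adj ((ε.trans (g i).symm) u) ((ε.trans (g i).symm) v) ∧
              ε u + ε v - 4 * (s + 1) * (i : ℕ) = a := by
          intro x y hxy ha
          refine ⟨ε.symm (g i x), ε.symm (g i y), by simpa using hxy, ?_⟩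
          rw [Equiv.apply_symm_apply, Equiv.apply_symm_apply, hg, hg, gridLabel, gridLabel, ← ha]
          ring
        simp only [adjacentSums, Finset.mem_insert, Finset.mem_singleton] at ha
        have adj : ∀ x y : Fin s × Fin s, ((x.1 : ℕ) + 1 = y.1 ∧ x.2 = y.2 ∨
            (x.2 : ℕ) + 1 = y.2 ∧ x.1 = y.1) → (grid s).Adj x y := by
          intro x y h
          simp only [grid, SimpleGraph.boxProd_adj, SimpleGraph.pathGraph_adj]
          tauto
        have hsn : s % 2 = 1 := Nat.odd_iff.1 hs
        -- All four sums occur near the corner: edges from the odd position 1 to 2 and to `s + 1`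
        -- give `2` and `2s`, edges from the even position 0 to 1 and to `s` give `-2` and `-2s`.
        rcases ha with ha | ha | ha | ha
        · refine mk (⟨0, by omega⟩, ⟨1, by omega⟩) (⟨0, by omega⟩, ⟨2, by omega⟩)
            (adj _ _ (.inr ⟨rfl, rfl⟩)) ?_
          rw [ha, zigzag_of_odd (by simp), zigzag_of_even (by simp)]
          push_cast; ring
        · refine mk (⟨0, by omega⟩, ⟨0, by omega⟩) (⟨0, by omega⟩, ⟨1, by omega⟩)
            (adj _ _ (.inr ⟨rfl, rfl⟩)) ?_
          rw [ha, zigzag_of_even (by simp), zigzag_of_odd (by simp)]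
          push_cast; ring
        · refine mk (⟨0, by omega⟩, ⟨1, by omega⟩) (⟨1, by omega⟩, ⟨1, by omega⟩)
            (adj _ _ (.inl ⟨rfl, rfl⟩)) ?_
          rw [ha, zigzag_of_odd (by simp), zigzag_of_even (by simp [hs.add_odd odd_one])]
          push_cast; ring
        · refine mk (⟨0, by omega⟩, ⟨0, by omega⟩) (⟨1, by omega⟩, ⟨0, by omega⟩)
            (adj _ _ (.inl ⟨rfl, rfl⟩)) ?_
          rw [ha, zigzag_of_even (by simp), zigzag_of_odd (by simpa using hs)]
          push_cast; ring
      obtain ⟨u, v, huv, rfl⟩ := hzero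
      have := hmem j u v ((hij u v).1 huv)
      have e : (ε u + ε v - 4 * (s + 1) * (i : ℕ) + (4 * (s + 1) * (i : ℕ) -
        4 * (s + 1) * (j : ℕ)) : ZMod n) = ε u + ε v - 4 * (s + 1) * (j : ℕ) := by ring
      rwa [e]
    exact hcast (hunit2.mul_left_cancel (sub_eq_zero.1 h0))
  · intro h7 i j hij hji u v hi hj
    exact gridLabel_windows_disjoint hs h7 hn hij hji (hmem i u v hi) (hmem j u v hj)

/-! ### Degrees and number of edges of the grid -/

theorem pathGraph_degree_le (s : ℕ) (a : Fin s) [Fintype ((SimpleGraph.pathGraph s).neighborSet a)] :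
    (SimpleGraph.pathGraph s).degree a ≤ 2 := by
  rw [← SimpleGraph.card_neighborFinset_eq_degree]
  have hsub : ((SimpleGraph.pathGraph s).neighborFinset a).image (fun b : Fin s => (b : ℕ)) ⊆
      {(a : ℕ) - 1, (a : ℕ) + 1} := by
    intro b hb
    simp only [Finset.mem_image, SimpleGraph.mem_neighborFinset, SimpleGraph.pathGraph_adj] at hb
    obtain ⟨c, hc, rfl⟩ := hb
    simp only [Finset.mem_insert, Finset.mem_singleton]
    omega
  rw [← Finset.card_image_of_injective _ Fin.val_injective]
  exact (Finset.card_le_card hsub).trans Finset.card_le_two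

open Classical in
theorem grid_degree_le (s : ℕ) (x : Fin s × Fin s) : (grid s).degree x ≤ 4 := by
  have := SimpleGraph.degree_boxProd (G := SimpleGraph.pathGraph s) (H := SimpleGraph.pathGraph s) x
  have h1 := pathGraph_degree_le s x.1
  have h2 := pathGraph_degree_le s x.2
  have e : (grid s).degree x = (SimpleGraph.pathGraph s).degree x.1 +
    (SimpleGraph.pathGraph s).degree x.2 := by rw [← this]; congr!
  omega

open Classical in
/-- The grid has at least (in fact, exactly) `4 * s * (s - 1)` directed edges. -/
theorem le_card_grid_adj (s : ℕ) :
    4 * (s * s) ≤ 4 * s + (Finset.univ.filter fun p : (Fin s × Fin s) × (Fin s × Fin s) =>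
      (grid s).Adj p.1 p.2).card := by
  obtain _ | m := s
  · simp
  set A : Finset ((Fin (m + 1) × Fin (m + 1)) × (Fin (m + 1) × Fin (m + 1))) :=
    Finset.univ.filter fun p => (grid (m + 1)).Adj p.1 p.2
  -- The Booleans choose the direction and the orientation of an edge; the pair names its line and
  -- its lower endpoint on that line.
  let f : (Bool × Bool) × (Fin (m + 1) × Fin m) →
      (Fin (m + 1) × Fin (m + 1)) × (Fin (m + 1) × Fin (m + 1)) := fun q =>
    let x := if q.1.1 then (q.2.1, q.2.2.castSucc) else (q.2.2.castSucc, q.2.1)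
    let y := if q.1.1 then (q.2.1, q.2.2.succ) else (q.2.2.succ, q.2.1)
    if q.1.2 then (x, y) else (y, x)
  have hf : Function.Injective f := by
    rintro ⟨⟨a, b⟩, c, d⟩ ⟨⟨a', b'⟩, c', d'⟩ h
    cases a <;> cases b <;> cases a' <;> cases b' <;>
      simp [f, Fin.ext_iff] at h ⊢ <;> omega
  have hle : (Finset.univ.map ⟨f, hf⟩).card ≤ A.card := by
    refine Finset.card_le_card fun p hp => ?_
    simp only [Finset.mem_map, Finset.mem_univ, true_and, Function.Embedding.coeFn_mk] at hp
    obtain ⟨⟨⟨a, b⟩, c, d⟩, rfl⟩ := hp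
    simp only [A, Finset.mem_filter, Finset.mem_univ, true_and, grid, SimpleGraph.boxProd_adj,
      SimpleGraph.pathGraph_adj]
    cases a <;> cases b <;> simp [f]
  rw [Finset.card_map, Finset.card_univ] at hle
  simp only [Fintype.card_prod, Fintype.card_fin, Fintype.card_bool] at hle
  nlinarith

/-! ### ReNet without large nodes -/

namespace ReNet

variable {n : ℕ}

/-- The pairs of known communication partners. -/
def State.known (st : State n) : Finset (Request n) :=
  Finset.univ.filter fun p => p.2 ∈ st.workingSet p.1

theorem mem_known {st : State n} {u v : Fin n} :
    (u, v) ∈ st.known ↔ v ∈ st.workingSet u := by simp [State.known]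

theorem card_known (st : State n) : st.known.card = ∑ x, (st.workingSet x).card := by
  rw [State.known, Finset.card_filter, Fintype.sum_prod_type]
  refine Finset.sum_congr rfl fun x _ => ?_
  rw [← Finset.card_filter]
  congr 1
  ext y; simp

/-- The number of known partners of `u`. -/
def outDegree (K : Finset (Request n)) (u : Fin n) : ℕ := (K.filter fun p => p.1 = u).card

theorem outDegree_mono {K K' : Finset (Request n)} (h : K ⊆ K') (u : Fin n) :
    outDegree K u ≤ outDegree K' u := Finset.card_le_card (Finset.filter_subset_filter _ h)

theorem outDegree_union_le (K K' : Finset (Request n)) (u : Fin n) :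
    outDegree (K ∪ K') u ≤ outDegree K u + outDegree K' u := by
  rw [outDegree, Finset.filter_union]; exact Finset.card_union_le _ _

theorem card_le_of_outDegree_le {K : Finset (Request n)} {d : ℕ} (h : ∀ u, outDegree K u ≤ d) :
    K.card ≤ d * n := by
  rw [Finset.card_eq_sum_card_fiberwise (f := Prod.fst) (t := Finset.univ) (by simp)]
  calc _ ≤ ∑ _u : Fin n, d := Finset.sum_le_sum fun u _ => h u
    _ = d * n := by simp [mul_comm]

theorem card_workingSet (st : State n) (u : Fin n) :
    (st.workingSet u).card = outDegree st.known u := by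
  rw [outDegree, ← Finset.card_map ⟨fun v => (u, v), Prod.mk_right_injective u⟩]
  congr 1
  ext ⟨a, b⟩
  simp only [Finset.mem_map, Function.Embedding.coeFn_mk, Prod.mk.injEq, Finset.mem_filter,
    mem_known]
  constructor
  · rintro ⟨v, hv, rfl, rfl⟩; exact ⟨hv, rfl⟩
  · rintro ⟨h, rfl⟩; exact ⟨b, h, rfl, rfl⟩

/-- Add `v` to the working set of `u`, without any further action. -/
def State.learn (st : State n) (u v : Fin n) : State n :=
  { st with workingSet := Function.update st.workingSet u (Insert.insert v (st.workingSet u)) }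

theorem known_learn (st : State n) (u v : Fin n) :
    (st.learn u v).known = insert (u, v) st.known := by
  ext ⟨a, b⟩
  simp only [mem_known, State.learn, Finset.mem_insert, Prod.mk.injEq]
  by_cases h : a = u
  · subst h; simp
  · simp [h]

/-- `makeLarge` is triggered only by a working set of exactly `θ + 1` elements. -/
theorem addPartner_of_small {D θ : ℕ} {st : State n} {u v : Fin n}
    (h : outDegree (insert (u, v) st.known) u ≤ θ) : st.addPartner D θ u v = st.learn u v := by
  rw [← known_learn, ← card_workingSet] at h
  unfold State.addPartner
  simp only
  rw [if_neg]
  · rfl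
  · rintro ⟨-, hc⟩
    exact absurd (hc.ge.trans h) (by omega)

/-- The direct links between the partners in `K`. -/
def links (K : Finset (Request n)) : Multiset (Sym2 (Fin n)) :=
  ((K.filter fun p => p.1 < p.2).val.map fun p => s(p.1, p.2)).filter fun e => ¬ e.IsDiag

/-- Without ego-trees the known pairs determine the network, so the analysis needs to track only
`large`, `known` and `cost`. -/
theorem network_of_small {st : State n} (h : st.large = ∅) : st.network = links st.known := by
  rw [State.network, links, State.directLinks, h]
  simp only [Finset.notMem_empty, not_false_eq_true, true_and, Finset.sum_empty, add_zero]
  congr 3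
  ext ⟨a, b⟩
  simp [State.known, and_comm]

theorem card_links_le (K : Finset (Request n)) : (links K).card ≤ K.card := by
  refine (Multiset.card_le_card (Multiset.filter_le _ _)).trans ?_
  rw [Multiset.card_map]
  exact Finset.card_le_card (Finset.filter_subset _ _)

theorem links_union {K X : Finset (Request n)} (h : Disjoint K X) :
    links (K ∪ X) = links K + links X := by
  rw [links, Finset.filter_union, ← Finset.disjUnion_eq_union _ _
    (Finset.disjoint_filter_filter h), Finset.disjUnion_val, Multiset.map_add, Multiset.filter_add]
  rfl

theorem adj_le (N N' : Multiset (Sym2 (Fin n))) : adj N N' ≤ N.card + N'.card :=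
  add_le_add (Multiset.card_le_card (Multiset.sub_le_self _ _))
    (Multiset.card_le_card (Multiset.sub_le_self _ _))

theorem adj_self (N : Multiset (Sym2 (Fin n))) : adj N N = 0 := by simp [adj]

theorem adj_links_insert (K : Finset (Request n)) (p q : Request n) :
    adj (links K) (links (insert p (insert q K))) ≤ 2 := by
  have e : insert p (insert q K) = K ∪ (({p, q} : Finset (Request n)) \ K) := by
    ext x; simp only [Finset.mem_insert, Finset.mem_union, Finset.mem_sdiff,
      Finset.mem_singleton]; tauto
  rw [e, links_union Finset.disjoint_sdiff, adj, tsub_eq_zero_of_le (Multiset.le_add_right _ _),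
    add_tsub_cancel_left, Multiset.card_zero, zero_add]
  exact (card_links_le _).trans ((Finset.card_le_card Finset.sdiff_subset).trans Finset.card_le_two)

theorem adjust_of_small {st : State n} (h : st.large = ∅) (u v : Fin n) :
    st.adjust u v = st := by simp [State.adjust, h]

theorem routeLength_of_small {st : State n} (h : st.large = ∅) (u v : Fin n) :
    st.routeLength u v = 1 := by simp [State.routeLength, h]

theorem addRoute_of_small {D θ : ℕ} {st : State n} {u v : Fin n} (h : st.large = ∅)
    (hr : ¬ θ * n ≤ 2 * st.known.card)
    (hu : outDegree (insert (v, u) (insert (u, v) st.known)) u ≤ θ)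
    (hv : outDegree (insert (v, u) (insert (u, v) st.known)) v ≤ θ) :
    st.addRoute D θ u v = ((st.pay (3 * D)).learn u v).learn v u := by
  have hk : (st.pay (3 * D)).known = st.known := rfl
  unfold State.addRoute
  simp only
  rw [← card_known, hk, if_neg hr,
    addPartner_of_small (st := st.pay (3 * D)) ((outDegree_mono (Finset.subset_insert _ _) u).trans hu),
    addPartner_of_small (by rw [known_learn, hk]; exact hv)]
  simp [State.learn, State.pay, h]

theorem known_init_cost (x : ℕ) : ({ init n with cost := x } : State n).known = ∅ := by
  ext ⟨a, b⟩; simp [mem_known, init]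

theorem outDegree_pair_le (p q : Request n) (u : Fin n) : outDegree {p, q} u ≤ 2 :=
  (Finset.card_le_card (Finset.filter_subset _ _)).trans Finset.card_le_two

theorem addRoute_of_reset {D θ : ℕ} {st : State n} {u v : Fin n}
    (hr : θ * n ≤ 2 * st.known.card) (hθ : 2 ≤ θ) :
    st.addRoute D θ u v = (((st.pay (3 * D)).reset).learn u v).learn v u := by
  have hk : (st.pay (3 * D)).known = st.known := rfl
  have hk0 : (st.pay (3 * D)).reset.known = ∅ := known_init_cost _
  unfold State.addRoute
  simp only
  rw [← card_known, hk, if_pos hr,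
    addPartner_of_small (st := (st.pay (3 * D)).reset) (v := v) (by
      rw [hk0]
      exact ((outDegree_mono (Finset.subset_insert (v, u) _) u).trans
        (outDegree_pair_le (v, u) (u, v) _)).trans hθ),
    addPartner_of_small (by
      rw [known_learn, hk0]; exact (outDegree_pair_le (v, u) (u, v) _).trans hθ)]
  simp [State.learn, State.reset, init]

/-- Requests between known small partners only cost their route. -/
theorem serve_known {D θ : ℕ} {st : State n} {u v : Fin n} (huv : u ≠ v) (h : st.large = ∅)
    (hk : (u, v) ∈ st.known) : st.serve D θ (u, v) = st.pay 1 := by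
  rw [mem_known] at hk
  simp only [State.serve, if_neg huv, if_pos hk]
  rw [adjust_of_small h, routeLength_of_small h, adj_self]

/-- A new partner costs a constant number of messages. -/
theorem serve_new {D θ : ℕ} {st : State n} {u v : Fin n} (huv : u ≠ v) (h : st.large = ∅)
    (hk : (u, v) ∉ st.known) (hr : ¬ θ * n ≤ 2 * st.known.card)
    (hu : outDegree (insert (v, u) (insert (u, v) st.known)) u ≤ θ)
    (hv : outDegree (insert (v, u) (insert (u, v) st.known)) v ≤ θ) :
    (st.serve D θ (u, v)).large = ∅ ∧
      (st.serve D θ (u, v)).known = insert (v, u) (insert (u, v) st.known) ∧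
      st.cost + 1 ≤ (st.serve D θ (u, v)).cost ∧
      (st.serve D θ (u, v)).cost ≤ st.cost + (3 * D + 3) := by
  have hk' := hk
  rw [mem_known] at hk'
  simp only [State.serve, if_neg huv, if_neg hk', h, Finset.notMem_empty, if_false]
  set st₀ := st.pay 0 with hst₀
  have h0 : st₀.large = ∅ := h
  have hk0 : st₀.known = st.known := rfl
  rw [addRoute_of_small h0 hr hu hv]
  set st₁ := ((st₀.pay (3 * D)).learn u v).learn v u with hst₁
  have h1 : st₁.large = ∅ := h
  have hk1 : st₁.known = insert (v, u) (insert (u, v) st.known) := by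
    rw [hst₁, known_learn, known_learn]; rfl
  have hc1 : st₁.cost = st.cost + 3 * D := rfl
  rw [adjust_of_small h1, routeLength_of_small h1, network_of_small h,
    network_of_small h1, hk1]
  have := adj_links_insert st.known (v, u) (u, v)
  refine ⟨h1, hk1, ?_, ?_⟩ <;> simp only [State.pay] <;> omega

/-- A reset costs a broadcast and the removal of all links. -/
theorem serve_reset {D θ : ℕ} {st : State n} {u v : Fin n} (huv : u ≠ v) (h : st.large = ∅)
    (hk : (u, v) ∉ st.known) (hr : θ * n ≤ 2 * st.known.card) (hθ : 2 ≤ θ) :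
    (st.serve D θ (u, v)).large = ∅ ∧
      (st.serve D θ (u, v)).known = {(v, u), (u, v)} ∧
      st.cost + 1 ≤ (st.serve D θ (u, v)).cost ∧
      (st.serve D θ (u, v)).cost ≤ st.cost + (3 * D + 3 + n + st.known.card) := by
  have hk' := hk
  rw [mem_known] at hk'
  simp only [State.serve, if_neg huv, if_neg hk', h, Finset.notMem_empty, if_false]
  set st₀ := st.pay 0 with hst₀
  have h0 : st₀.large = ∅ := h
  rw [addRoute_of_reset (st := st₀) hr hθ]
  set st₁ := (((st₀.pay (3 * D)).reset).learn u v).learn v u with hst₁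
  have h1 : st₁.large = ∅ := rfl
  have hk1 : st₁.known = {(v, u), (u, v)} := by
    rw [hst₁, known_learn, known_learn,
      show (st₀.pay (3 * D)).reset.known = ∅ from known_init_cost _]
    rfl
  have hc1 : st₁.cost = st.cost + 3 * D + n := rfl
  rw [adjust_of_small h1, routeLength_of_small h1, network_of_small h,
    network_of_small h1, hk1]
  have e1 := adj_le (links st.known) (links {(v, u), (u, v)})
  have e2 := card_links_le st.known
  have e3 := (card_links_le {(v, u), (u, v)}).trans (Finset.card_le_two (a := (v, u)) (b := (u, v)))
  refine ⟨h1, hk1, ?_, ?_⟩ <;> simp only [State.pay] <;> omega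

end ReNet

/-! ### Windows, resets and the invariant between windows -/

namespace ReNet

variable {n : ℕ}

/-- As long as only the pairs in a small set `E` are known and requested, there is no reset, and
every pair is discovered at most once. -/
theorem foldl_serve_of_known_subset {D θ : ℕ} {E : Finset (Request n)}
    (hsym : ∀ u v, (u, v) ∈ E → (v, u) ∈ E) (hirr : ∀ u v, (u, v) ∈ E → u ≠ v)
    (hdeg : ∀ u, outDegree E u ≤ θ) (hcard : 2 * E.card < θ * n) (l : List (Request n)) :
    ∀ st : State n, (∀ q ∈ l, q ∈ E) → st.large = ∅ → st.known ⊆ E →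
      (l.foldl (State.serve D θ) st).large = ∅ ∧ (l.foldl (State.serve D θ) st).known ⊆ E ∧
      st.cost + l.length ≤ (l.foldl (State.serve D θ) st).cost ∧
      (l.foldl (State.serve D θ) st).cost ≤
        st.cost + l.length + (3 * D + 2) * (E \ st.known).card := by
  induction l with
  | nil => intro st _ h1 h2; exact ⟨h1, h2, by simp, by simp⟩
  | cons q l ih =>
    intro st hl h1 h2
    obtain ⟨u, v⟩ := q
    have huv := hl _ List.mem_cons_self
    have hl' : ∀ q ∈ l, q ∈ E := fun q hq => hl q (List.mem_cons_of_mem _ hq)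
    rw [List.foldl_cons, List.length_cons]
    by_cases hk : (u, v) ∈ st.known
    · have e := serve_known (D := D) (θ := θ) (hirr _ _ huv) h1 hk
      rw [e]
      obtain ⟨a, b, c, d⟩ := ih (st.pay 1) hl' h1 h2
      have hc : (st.pay 1).cost = st.cost + 1 := rfl
      have hkn : (st.pay 1).known = st.known := rfl
      rw [hc] at c d
      rw [hkn] at d
      exact ⟨a, b, by omega, by omega⟩
    · have hsub : insert (v, u) (insert (u, v) st.known) ⊆ E := by
        simp only [Finset.insert_subset_iff]
        exact ⟨hsym _ _ huv, huv, h2⟩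
      have hr : ¬ θ * n ≤ 2 * st.known.card := by
        have := Finset.card_le_card h2
        omega
      obtain ⟨e1, e2, e3, e4⟩ := serve_new (D := D) (hirr _ _ huv) h1 hk hr
        ((outDegree_mono hsub u).trans (hdeg u)) ((outDegree_mono hsub v).trans (hdeg v))
      obtain ⟨a, b, c, d⟩ := ih _ hl' e1 (by rw [e2]; exact hsub)
      have hlt : (E \ (st.serve D θ (u, v)).known).card + 1 ≤ (E \ st.known).card := by
        refine Finset.card_lt_card ⟨?_, fun hc => ?_⟩
        · refine Finset.sdiff_subset_sdiff le_rfl ?_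
          rw [e2]
          exact (Finset.subset_insert _ _).trans (Finset.subset_insert _ _)
        · have := hc (Finset.mem_sdiff.2 ⟨huv, hk⟩)
          simp [e2] at this
      have := Nat.mul_le_mul_left (3 * D + 2) hlt
      rw [mul_add] at this
      exact ⟨a, b, by omega, by omega⟩

/-- While the requests come from a small set `E`, there is at most one reset. -/
theorem foldl_serve_window {D θ : ℕ} {E : Finset (Request n)} (hθ : 2 ≤ θ)
    (hsym : ∀ u v, (u, v) ∈ E → (v, u) ∈ E) (hirr : ∀ u v, (u, v) ∈ E → u ≠ v)
    (hcard : 2 * E.card < θ * n) (l : List (Request n)) :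
    ∀ st : State n, (∀ q ∈ l, q ∈ E) → st.large = ∅ →
      (∀ u, outDegree (st.known ∪ E) u ≤ θ) →
      (l.foldl (State.serve D θ) st).large = ∅ ∧
      -- The first alternative is the outcome of a reset. In the second nothing was forgotten, and
      -- if anything was learned, the initial state was below the reset threshold.
      ((l.foldl (State.serve D θ) st).known ⊆ E ∨
        (st.known ⊆ (l.foldl (State.serve D θ) st).known ∧
          (∀ q ∈ l, q ∈ (l.foldl (State.serve D θ) st).known) ∧
          (l.foldl (State.serve D θ) st).known ⊆ st.known ∪ E ∧
          ((l.foldl (State.serve D θ) st).known = st.known ∨ 2 * st.known.card < θ * n))) ∧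
      st.cost + l.length ≤ (l.foldl (State.serve D θ) st).cost ∧
      (l.foldl (State.serve D θ) st).cost ≤
        st.cost + l.length + (3 * D + 2) * (E \ st.known).card +
          (3 * D + 2 + n + (st.known ∪ E).card + (3 * D + 2) * E.card) := by
  induction l with
  | nil => intro st _ h1 _; exact ⟨h1, by simp, by simp, by simp; omega⟩
  | cons q l ih =>
    intro st hl h1 h2
    obtain ⟨u, v⟩ := q
    have huv := hl _ List.mem_cons_self
    have hl' : ∀ q ∈ l, q ∈ E := fun q hq => hl q (List.mem_cons_of_mem _ hq)
    rw [List.foldl_cons, List.length_cons]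
    by_cases hk : (u, v) ∈ st.known
    · have e := serve_known (D := D) (θ := θ) (hirr _ _ huv) h1 hk
      rw [e]
      obtain ⟨a, b, c, d⟩ := ih (st.pay 1) hl' h1 h2
      have hc : (st.pay 1).cost = st.cost + 1 := rfl
      have hkn : (st.pay 1).known = st.known := rfl
      rw [hc] at c d
      rw [hkn] at b d
      refine ⟨a, b.imp_right fun ⟨b1, b2, b3⟩ => ⟨b1, ?_, b3⟩, by omega, by omega⟩
      simp only [List.mem_cons, forall_eq_or_imp]
      exact ⟨b1 hk, b2⟩
    · by_cases hr : θ * n ≤ 2 * st.known.card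
      -- From here on only pairs of `E` are known, and `2 * E.card < θ * n` rules out a second
      -- reset.
      · obtain ⟨e1, e2, e3, e4⟩ := serve_reset (D := D) (hirr _ _ huv) h1 hk hr hθ
        obtain ⟨a, b, c, d⟩ := foldl_serve_of_known_subset (D := D) hsym hirr
          (fun u => (outDegree_mono Finset.subset_union_right u).trans (h2 u)) hcard l _ hl' e1 (by
            rw [e2]
            simp only [Finset.insert_subset_iff, Finset.singleton_subset_iff]
            exact ⟨hsym _ _ huv, huv⟩)
        refine ⟨a, .inl b, by omega, ?_⟩
        have g1 := Nat.mul_le_mul_left (3 * D + 2)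
          (Finset.card_le_card (Finset.sdiff_subset (s := E) (t := (st.serve D θ (u, v)).known)))
        have g2 := Finset.card_le_card (Finset.subset_union_left (s₁ := st.known) (s₂ := E))
        omega
      · have hsub : insert (v, u) (insert (u, v) st.known) ⊆ st.known ∪ E := by
          simp only [Finset.insert_subset_iff, Finset.mem_union]
          exact ⟨.inr (hsym _ _ huv), .inr huv, Finset.subset_union_left⟩
        obtain ⟨e1, e2, e3, e4⟩ := serve_new (D := D) (hirr _ _ huv) h1 hk hr
          ((outDegree_mono hsub u).trans (h2 u)) ((outDegree_mono hsub v).trans (h2 v))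
        have hun : (st.serve D θ (u, v)).known ∪ E = st.known ∪ E := by
          rw [e2]
          exact Finset.Subset.antisymm (Finset.union_subset hsub Finset.subset_union_right)
            (Finset.union_subset_union_left
              ((Finset.subset_insert _ _).trans (Finset.subset_insert _ _)))
        have hinc : st.known ⊆ (st.serve D θ (u, v)).known := by
          rw [e2]
          exact (Finset.subset_insert _ _).trans (Finset.subset_insert _ _)
        have huv' : (u, v) ∈ (st.serve D θ (u, v)).known := by simp [e2]
        obtain ⟨a, b, c, d⟩ := ih _ hl' e1 (by rw [hun]; exact h2)
        rw [hun] at b d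
        have hlt : (E \ (st.serve D θ (u, v)).known).card + 1 ≤ (E \ st.known).card := by
          refine Finset.card_lt_card ⟨Finset.sdiff_subset_sdiff le_rfl hinc, fun hc => ?_⟩
          exact (Finset.mem_sdiff.1 (hc (Finset.mem_sdiff.2 ⟨huv, hk⟩))).2 huv'
        have := Nat.mul_le_mul_left (3 * D + 2) hlt
        rw [mul_add] at this
        refine ⟨a, b.imp_right fun ⟨b1, b2, b3, _⟩ => ⟨hinc.trans b1, ?_, b3, .inr (by omega)⟩,
          by omega, by omega⟩
        simp only [List.mem_cons, forall_eq_or_imp]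
        exact ⟨b1 huv', b2⟩

/-- The invariant before window `i` of a demand with edge sets `E`: all nodes are small, and unless
`n` is small, all windows since some window `j` are known. -/
structure Calm (E : Fin n → Finset (Request n)) (i : ℕ) (st : State n) : Prop where
  large : st.large = ∅
  irrefl : ∀ u, (u, u) ∉ st.known
  degree : ∀ u, outDegree st.known u ≤ 24
  -- Think of `j` as the window of the last reset (0 at the start). The inequality `j < m` is strict
  -- because a reset in the middle of window `j` forgets its earlier pairs. For `n ≤ 25` no
  -- disjointness is available, but degrees below `n` are at most 24 anyway.
  recent : n ≤ 25 ∨ ∃ j ≤ i, (∀ m : Fin n, j < m → (m : ℕ) < i → E m ⊆ st.known) ∧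
    ∀ u, outDegree st.known u ≤ 4 * min (i - j) 6

theorem calm_init (E : Fin n → Finset (Request n)) : Calm E 0 (init n) := by
  have h : (init n).known = ∅ := known_init_cost 0
  refine ⟨rfl, by simp [h], by simp [h, outDegree], .inr ⟨0, le_rfl, ?_, by simp [h, outDegree]⟩⟩
  intro m _ hm
  omega

theorem outDegree_lt {K : Finset (Request n)} (h : ∀ u, (u, u) ∉ K) (u : Fin n) :
    outDegree K u < n := by
  have hsub : (K.filter fun p => p.1 = u) ⊆ (Finset.univ.erase u).image fun v => (u, v) := by
    rintro ⟨a, v⟩ hv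
    obtain ⟨hK, rfl⟩ := Finset.mem_filter.1 hv
    refine Finset.mem_image.2 ⟨v, Finset.mem_erase.2 ⟨?_, Finset.mem_univ _⟩, rfl⟩
    rintro rfl
    exact h _ hK
  have := (Finset.card_le_card hsub).trans Finset.card_image_le
  rw [Finset.card_erase_of_mem (Finset.mem_univ _), Finset.card_univ, Fintype.card_fin] at this
  have := u.pos
  rw [outDegree]
  omega

/-- One window of a demand of the kind considered here. -/
theorem Calm.window {D : ℕ} {E : Fin n → Finset (Request n)}
    (hsym : ∀ i u v, (u, v) ∈ E i → (v, u) ∈ E i) (hirr : ∀ i u v, (u, v) ∈ E i → u ≠ v)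
    (hdeg : ∀ i u, outDegree (E i) u ≤ 4)
    (hsat : 25 < n → ∀ (i j : ℕ) (K : Finset (Request n)), i < n → j + 6 ≤ i →
      (∀ m : Fin n, j < m → (m : ℕ) < i → E m ⊆ K) → 16 * n ≤ K.card)
    {i : Fin n} {st : State n} (h : Calm E i st) {l : List (Request n)}
    (hl : ∀ q, q ∈ l ↔ q ∈ E i) :
    Calm E (i + 1) (l.foldl (State.serve D 32) st) ∧
      st.cost + l.length ≤ (l.foldl (State.serve D 32) st).cost ∧
      (l.foldl (State.serve D 32) st).cost ≤
        st.cost + l.length + ((3 * D + 2) * (8 * n + 1) + 29 * n) := by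
  have hn : 0 < n := i.pos
  have hE : (E i).card ≤ 4 * n := card_le_of_outDegree_le (hdeg i)
  have hun : ∀ u, outDegree (st.known ∪ E i) u ≤ 28 := fun u =>
    (outDegree_union_le _ _ u).trans (add_le_add (h.degree u) (hdeg i u))
  obtain ⟨a, b, c, d⟩ := foldl_serve_window (D := D) (θ := 32) (by norm_num) (hsym i) (hirr i)
    (by omega) l st (fun q hq => (hl q).1 hq) h.large (fun u => (hun u).trans (by norm_num))
  refine ⟨?_, c, ?_⟩
  · have hsub : (l.foldl (State.serve D 32) st).known ⊆ st.known ∪ E i := by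
      rcases b with b | b
      · exact b.trans Finset.subset_union_right
      · exact b.2.2.1
    have hirr' : ∀ u, (u, u) ∉ (l.foldl (State.serve D 32) st).known := by
      intro u hu
      rcases Finset.mem_union.1 (hsub hu) with hu | hu
      · exact h.irrefl u hu
      · exact hirr i u u hu rfl
    have hrec : n ≤ 25 ∨ ∃ j ≤ (i : ℕ) + 1,
        (∀ m : Fin n, j < m → (m : ℕ) < i + 1 → E m ⊆ (l.foldl (State.serve D 32) st).known) ∧
        ∀ u, outDegree (l.foldl (State.serve D 32) st).known u ≤ 4 * min ((i : ℕ) + 1 - j) 6 := by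
      by_cases hn25 : n ≤ 25
      · exact .inl hn25
      right
      rcases b with b | ⟨b1, b2, b3, b4⟩
      · refine ⟨i, by omega, fun m h1 h2 => by omega, fun u => ?_⟩
        exact ((outDegree_mono b u).trans (hdeg i u)).trans (by omega)
      · obtain ⟨j, hj, hj1, hj2⟩ := h.recent.resolve_left hn25
        refine ⟨j, by omega, fun m h1 h2 => ?_, fun u => ?_⟩
        · rcases (Nat.lt_succ_iff.1 h2).lt_or_eq with h3 | h3
          · exact (hj1 m h1 h3).trans b1
          · rw [Fin.ext h3]
            exact fun q hq => b2 q ((hl q).2 hq)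
        · rcases b4 with b4 | b4
          · rw [b4]
            exact (hj2 u).trans (by omega)
          -- Otherwise windows `j + 1, …, j + 5` would all be known, that is `16n = θn/2` pairs, and
          -- the first new pair would have caused a reset. So `i - j ≤ 5`, which leaves room for one
          -- more window.
          · have hij : ¬ j + 6 ≤ i := fun hc => by
              have := hsat (by omega) i j st.known i.2 hc hj1
              omega
            have h1 := (outDegree_mono b3 u).trans (outDegree_union_le _ _ u)
            have h2 := hj2 u
            have h3 := hdeg i u
            omega
    refine ⟨a, hirr', fun u => ?_, hrec⟩
    rcases hrec with h25 | ⟨j, -, -, hj⟩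
    · have := outDegree_lt hirr' u
      omega
    · exact (hj u).trans (by omega)
  -- Up to `4n` discoveries before the reset, `4n` after it and the resetting request itself cost
  -- `3D + 2` each beyond the route; the broadcast costs `n` and the link removals at most `28n`.
  · have h1 : (st.known ∪ E i).card ≤ 28 * n := card_le_of_outDegree_le hun
    have h2 : (E i \ st.known).card ≤ 4 * n := (Finset.card_le_card Finset.sdiff_subset).trans hE
    have h3 := Nat.mul_le_mul_left (3 * D + 2) h2
    have h4 := Nat.mul_le_mul_left (3 * D + 2) hE
    have h5 : (3 * D + 2) * (8 * n + 1) = (3 * D + 2) * (4 * n) + (3 * D + 2) * (4 * n) +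
      (3 * D + 2) := by ring
    omega

/-- ReNet serves a demand of long windows of this kind at constant cost per request. -/
theorem run_windows {D : ℕ} {E : Fin n → Finset (Request n)}
    (hsym : ∀ i u v, (u, v) ∈ E i → (v, u) ∈ E i) (hirr : ∀ i u v, (u, v) ∈ E i → u ≠ v)
    (hdeg : ∀ i u, outDegree (E i) u ≤ 4)
    (hsat : 25 < n → ∀ (i j : ℕ) (K : Finset (Request n)), i < n → j + 6 ≤ i →
      (∀ m : Fin n, j < m → (m : ℕ) < i → E m ⊆ K) → 16 * n ≤ K.card)
    {w : Fin n → List (Request n)} (hw : ∀ i q, q ∈ w i ↔ q ∈ E i)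
    (hlen : ∀ i, (3 * D + 2) * (8 * n + 1) + 29 * n ≤ 6 * (w i).length) :
    (∀ i, totalCost D 32 (demandBefore w i ++ w i) ≤
      totalCost D 32 (demandBefore w i) + 7 * (w i).length) ∧
    (concatDemand w).length ≤ totalCost D 32 (concatDemand w) ∧
    totalCost D 32 (concatDemand w) ≤ 7 * (concatDemand w).length := by
  have step : ∀ i (hi : i < n), ((List.ofFn w).take (i + 1)).flatten =
      ((List.ofFn w).take i).flatten ++ w ⟨i, hi⟩ := by
    intro i hi
    rw [List.take_add_one, List.flatten_append]
    simp [hi]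
  have main : ∀ i ≤ n, Calm E i (run D 32 ((List.ofFn w).take i).flatten) ∧
      ((List.ofFn w).take i).flatten.length ≤ totalCost D 32 ((List.ofFn w).take i).flatten ∧
      totalCost D 32 ((List.ofFn w).take i).flatten ≤
        7 * ((List.ofFn w).take i).flatten.length := by
    intro i
    induction i with
    | zero => intro _; simpa [run, totalCost, init] using calm_init E
    | succ i ih =>
      intro hi
      obtain ⟨h1, h2, h3⟩ := ih (by omega)
      obtain ⟨g1, g2, g3⟩ := Calm.window (D := D) hsym hirr hdeg hsat (i := ⟨i, hi⟩) h1 (hw ⟨i, hi⟩)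
      have := hlen ⟨i, hi⟩
      simp only [totalCost, run] at h2 h3 g1 g2 g3 ⊢
      rw [step i hi, List.foldl_append, List.length_append]
      exact ⟨g1, by omega, by omega⟩
  refine ⟨fun i => ?_, ?_, ?_⟩
  · obtain ⟨h1, h2, h3⟩ := main i i.2.le
    obtain ⟨g1, g2, g3⟩ := Calm.window (D := D) hsym hirr hdeg hsat h1 (hw i)
    have := hlen i
    simp only [totalCost, run, demandBefore, List.foldl_append] at g2 g3 ⊢
    omega
  · have := (main n le_rfl).2.1
    rwa [List.take_of_length_le (by simp)] at this
  · have := (main n le_rfl).2.2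
    rwa [List.take_of_length_le (by simp)] at this

end ReNet

/-! ### Sparsity of a concatenation -/

theorem exists_cover_of_prefix_flatten {α : Type*} {δ : ℕ} {L : List (List α)}
    (hL : ∀ A ∈ L, δ ≤ A.length) {τ : List α} (hτ : τ <+: L.flatten) (hlen : τ.length ≤ δ) :
    τ = [] ∨ ∃ A ∈ L, τ ⊆ A := by
  cases L with
  | nil => left; simpa using hτ
  | cons A L =>
    right
    refine ⟨A, List.mem_cons_self, ?_⟩
    rw [List.flatten_cons] at hτ
    exact (List.prefix_of_prefix_length_le hτ (List.prefix_append _ _)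
      (hlen.trans (hL A List.mem_cons_self))).subset

/-- A short infix of a concatenation of long lists meets at most two of them. -/
theorem exists_cover_of_infix_flatten {α : Type*} {δ : ℕ} {L : List (List α)}
    (hL : ∀ A ∈ L, δ ≤ A.length) {τ : List α} (hτ : τ <:+: L.flatten) (hlen : τ.length ≤ δ) :
    τ = [] ∨ ∃ A ∈ L, ∃ B ∈ L, ∀ x ∈ τ, x ∈ A ∨ x ∈ B := by
  induction L with
  | nil => left; simpa using hτ
  | cons A L ih =>
    have hA := List.mem_cons_self (a := A) (l := L)
    have hL' : ∀ A ∈ L, δ ≤ A.length := fun B hB => hL B (List.mem_cons_of_mem _ hB)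
    rw [List.flatten_cons, List.infix_append_iff] at hτ
    rcases hτ with h | h | ⟨l₁, l₂, rfl, h1, h2⟩
    · exact .inr ⟨A, hA, A, hA, fun x hx => .inl (h.subset hx)⟩
    · rcases ih hL' h with h | ⟨B, hB, C, hC, h⟩
      · exact .inl h
      · exact .inr ⟨B, List.mem_cons_of_mem _ hB, C, List.mem_cons_of_mem _ hC, h⟩
    · right
      rcases exists_cover_of_prefix_flatten hL' h2 (by simp at hlen; omega) with rfl | ⟨B, hB, h⟩
      · exact ⟨A, hA, A, hA, fun x hx => .inl (h1.subset (by simpa using hx))⟩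
      · refine ⟨A, hA, B, List.mem_cons_of_mem _ hB, fun x hx => ?_⟩
        rcases List.mem_append.1 hx with hx | hx
        · exact .inl (h1.subset hx)
        · exact .inr (h hx)

/-- A piece no longer than any window meets at most two of them. With at most `4n` directed edges
per grid this gives `c = 8`. -/
theorem isSparse_concatDemand {n k c δ : ℕ} {w : Fin k → List (Request n)}
    (hlen : ∀ i, δ ≤ (w i).length) (hcard : ∀ i, 2 * (demandEdges (w i)).card ≤ c * n) :
    IsSparse c δ (concatDemand w) := by
  intro τ hτ hτδ
  rcases exists_cover_of_infix_flatten (by simpa [List.mem_ofFn] using hlen) hτ hτδ with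
    rfl | ⟨A, hA, B, hB, h⟩
  · simp [demandEdges]
  · simp only [List.mem_ofFn] at hA hB
    obtain ⟨i, rfl⟩ := hA
    obtain ⟨j, rfl⟩ := hB
    have hsub : demandEdges τ ⊆ demandEdges (w i) ∪ demandEdges (w j) := by
      intro x hx
      simp only [demandEdges, Finset.mem_union, List.mem_toFinset] at hx ⊢
      exact h x hx
    have h1 := (Finset.card_le_card hsub).trans (Finset.card_union_le _ _)
    have h2 := hcard i
    have h3 := hcard j
    omega

/-! ### Static networks -/

open Classical in
/-- The number of nodes that can be reached by walks of length at most `k`. -/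
theorem card_walk_ball_le {V : Type*} [Fintype V] {G : SimpleGraph V} {Δ : ℕ}
    (h : ∀ v, (G.neighborSet v).ncard ≤ Δ) (k : ℕ) (u : V) :
    (Finset.univ.filter fun v => ∃ p : G.Walk u v, p.length ≤ k).card ≤ (Δ + 1) ^ k := by
  induction k generalizing u with
  | zero =>
    rw [pow_zero, Finset.card_le_one]
    intro a ha b hb
    simp only [Finset.mem_filter, Finset.mem_univ, true_and, Nat.le_zero] at ha hb
    obtain ⟨p, hp⟩ := ha
    obtain ⟨q, hq⟩ := hb
    rw [← SimpleGraph.Walk.eq_of_length_eq_zero hp, ← SimpleGraph.Walk.eq_of_length_eq_zero hq]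
  | succ k ih =>
    have hsub : (Finset.univ.filter fun v => ∃ p : G.Walk u v, p.length ≤ k + 1) ⊆
        {u} ∪ (G.neighborSet u).toFinset.biUnion fun x =>
          Finset.univ.filter fun v => ∃ p : G.Walk x v, p.length ≤ k := by
      intro v hv
      simp only [Finset.mem_filter, Finset.mem_univ, true_and] at hv
      obtain ⟨p, hp⟩ := hv
      cases p with
      | nil => simp
      | cons hux q =>
        rw [SimpleGraph.Walk.length_cons] at hp
        refine Finset.mem_union_right _ (Finset.mem_biUnion.2 ⟨_, by simpa using hux, ?_⟩)
        simp only [Finset.mem_filter, Finset.mem_univ, true_and]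
        exact ⟨q, by omega⟩
    have hcard : (G.neighborSet u).toFinset.card ≤ Δ := by
      rw [← Set.ncard_eq_toFinset_card']; exact h u
    calc _ ≤ 1 + Δ * (Δ + 1) ^ k := by
          refine (Finset.card_le_card hsub).trans ((Finset.card_union_le _ _).trans ?_)
          rw [Finset.card_singleton]
          refine Nat.add_le_add_left ?_ 1
          exact (Finset.card_biUnion_le_card_mul _ _ _ fun x _ => ih x).trans
            (Nat.mul_le_mul_right _ hcard)
      _ ≤ (Δ + 1) ^ (k + 1) := by
          have : 1 ≤ (Δ + 1) ^ k := Nat.one_le_pow _ _ (by omega)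
          rw [pow_succ]; nlinarith

/-- In a network of degree at most `Δ`, most nodes are far away. -/
theorem le_sum_edist {n Δ k : ℕ} {G : SimpleGraph (Fin n)}
    (h : ∀ v, (G.neighborSet v).ncard ≤ Δ) (hk : 2 * (Δ + 1) ^ k ≤ n) (u : Fin n) :
    ((n : ℝ≥0∞) / 2) * (k + 1) ≤ ∑ v, ((G.edist u v : ℕ∞) : ℝ≥0∞) := by
  classical
  set F := Finset.univ.filter fun v => ∃ p : G.Walk u v, p.length ≤ k with hF
  have hcard : n ≤ 2 * Fᶜ.card := by
    have h1 : F.card ≤ (Δ + 1) ^ k := by rw [hF]; convert card_walk_ball_le h k u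
    have h2 := Finset.card_compl_add_card F
    rw [Fintype.card_fin] at h2
    omega
  have hfar : ∀ v ∈ Fᶜ, ((k : ℝ≥0∞) + 1) ≤ ((G.edist u v : ℕ∞) : ℝ≥0∞) := by
    intro v hv
    have : ((k + 1 : ℕ) : ℕ∞) ≤ G.edist u v := by
      rw [SimpleGraph.edist]
      refine le_iInf fun p => ?_
      simp only [hF, Finset.mem_compl, Finset.mem_filter, Finset.mem_univ, true_and, not_exists,
        not_le] at hv
      exact_mod_cast hv p
    calc ((k : ℝ≥0∞) + 1) = (((k + 1 : ℕ) : ℕ∞) : ℝ≥0∞) := by push_cast; rfl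
      _ ≤ _ := ENat.toENNReal_le.2 this
  calc ((n : ℝ≥0∞) / 2) * (k + 1) ≤ Fᶜ.card * (k + 1) := by
        gcongr
        refine ENNReal.div_le_of_le_mul ?_
        rw [mul_comm]
        exact_mod_cast hcard
    _ = ∑ _v ∈ Fᶜ, ((k : ℝ≥0∞) + 1) := by rw [Finset.sum_const, nsmul_eq_mul]
    _ ≤ ∑ v ∈ Fᶜ, ((G.edist u v : ℕ∞) : ℝ≥0∞) := Finset.sum_le_sum hfar
    _ ≤ _ := Finset.sum_le_sum_of_subset (Finset.subset_univ _)

theorem sum_uniformDemand {n L : ℕ} {σ : List (Request n)} (hmem : ∀ u v, (u, v) ∈ σ ↔ u ≠ v)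
    (hcount : ∀ u v, u ≠ v → σ.count (u, v) = L) {f : Request n → ℝ≥0∞} (hf : ∀ u, f (u, u) = 0) :
    (σ.map f).sum = L * ∑ u, ∑ v, f (u, v) := by
  rw [Finset.sum_list_map_count, ← Fintype.sum_prod_type', Finset.mul_sum]
  refine (Finset.sum_congr rfl fun p hp => ?_).trans
    (Finset.sum_subset (Finset.subset_univ _) fun p _ hp => ?_)
  · obtain ⟨u, v⟩ := p
    have := hcount u v ((hmem u v).1 (List.mem_toFinset.1 hp))
    rw [nsmul_eq_mul, ← this]
    congr!
  · obtain ⟨u, v⟩ := p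
    have : u = v := by
      by_contra hc
      exact hp (List.mem_toFinset.2 ((hmem u v).2 hc))
    rw [this, hf, mul_zero]

theorem length_uniformDemand {n L : ℕ} {σ : List (Request n)} (hmem : ∀ u v, (u, v) ∈ σ ↔ u ≠ v)
    (hcount : ∀ u v, u ≠ v → σ.count (u, v) = L) : σ.length = L * (n * n - n) := by
  have h1 : σ.toFinset = Finset.univ.offDiag := by
    ext ⟨u, v⟩
    simp [hmem]
  rw [← List.sum_toFinset_count_eq_length, h1, Finset.sum_congr rfl (g := fun _ => L)]
  · simp [Finset.offDiag_card, mul_comm]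
  · rintro ⟨u, v⟩ h
    rw [← hcount u v (by simpa using h)]
    congr!

/-- On a uniform demand, every network of bounded degree has logarithmic cost. -/
theorem le_statCost {n Δ k L : ℕ} {σ : List (Request n)}
    (hmem : ∀ u v, (u, v) ∈ σ ↔ u ≠ v) (hcount : ∀ u v, u ≠ v → σ.count (u, v) = L)
    (hk : 2 * (Δ + 1) ^ k ≤ n) (hσ : σ ≠ []) : ((k : ℝ≥0∞) + 1) / 2 ≤ statCost Δ σ := by
  refine le_iInf fun N => ?_
  have hpos : (σ.length : ℝ≥0∞) ≠ 0 := by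
    simpa using hσ
  rw [staticRouteCost, ENNReal.le_div_iff_mul_le (.inl hpos) (.inl (ENNReal.natCast_ne_top _)),
    sum_uniformDemand hmem hcount (by simp), length_uniformDemand hmem hcount]
  calc ((k : ℝ≥0∞) + 1) / 2 * ((L * (n * n - n) : ℕ) : ℝ≥0∞)
      ≤ ((k : ℝ≥0∞) + 1) / 2 * ((L * (n * n) : ℕ) : ℝ≥0∞) := by
        gcongr; exact Nat.sub_le _ _
    _ = L * ∑ _u : Fin n, ((n : ℝ≥0∞) / 2) * (k + 1) := by
        rw [Finset.sum_const, nsmul_eq_mul, Finset.card_univ, Fintype.card_fin]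
        push_cast
        simp only [div_eq_mul_inv]
        ring
    _ ≤ _ := by
        gcongr with u
        exact le_sum_edist N.2 hk u

/-! ### A static network of logarithmic cost -/

/-- The binary tree on `0, …, n - 1` in which the parent of `v` is `v / 2`. -/
def heapTree (n : ℕ) : SimpleGraph (Fin n) where
  Adj u v := u ≠ v ∧ ((u : ℕ) / 2 = v ∨ (v : ℕ) / 2 = u)
  symm := ⟨fun _ _ h => ⟨h.1.symm, h.2.symm⟩⟩
  loopless := ⟨fun _ h => h.1 rfl⟩

theorem heapTree_degree (n : ℕ) (v : Fin n) : ((heapTree n).neighborSet v).ncard ≤ 3 := by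
  have hsub : (fun x : Fin n => (x : ℕ)) '' (heapTree n).neighborSet v ⊆
      (({(v : ℕ) / 2, 2 * (v : ℕ), 2 * (v : ℕ) + 1} : Finset ℕ) : Set ℕ) := by
    rintro _ ⟨x, hx, rfl⟩
    have : (v : ℕ) / 2 = x ∨ (x : ℕ) / 2 = v := hx.2
    simp only [Finset.coe_insert, Finset.coe_singleton, Set.mem_insert_iff, Set.mem_singleton_iff]
    omega
  rw [← Set.ncard_image_of_injective _ Fin.val_injective]
  refine (Set.ncard_le_ncard hsub (Finset.finite_toSet _)).trans ?_
  rw [Set.ncard_coe_finset]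
  exact Finset.card_le_three

theorem heapTree_edist_zero {n : ℕ} (hn : 0 < n) (k : ℕ) :
    ∀ v : Fin n, (v : ℕ) < 2 ^ k → (heapTree n).edist v ⟨0, hn⟩ ≤ k := by
  induction k with
  | zero =>
    intro v hv
    have : v = ⟨0, hn⟩ := Fin.ext (by simpa using hv)
    simp [this]
  | succ k ih =>
    intro v hv
    have hlt : (v : ℕ) / 2 < n := (Nat.div_le_self _ _).trans_lt v.2
    have h1 := ih ⟨(v : ℕ) / 2, hlt⟩ (by simp only; rw [pow_succ] at hv; omega)
    by_cases h0 : v = ⟨(v : ℕ) / 2, hlt⟩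
    · rw [← h0] at h1
      exact h1.trans (by exact_mod_cast Nat.le_succ k)
    · have hadj : (heapTree n).Adj v ⟨(v : ℕ) / 2, hlt⟩ := ⟨h0, .inl rfl⟩
      calc _ ≤ (heapTree n).edist v ⟨(v : ℕ) / 2, hlt⟩ +
            (heapTree n).edist ⟨(v : ℕ) / 2, hlt⟩ ⟨0, hn⟩ := SimpleGraph.edist_triangle
        _ ≤ 1 + k := by
            gcongr
            exact (SimpleGraph.edist_eq_one_iff_adj.2 hadj).le
        _ = _ := by push_cast; ring

/-- Every route can pass through the root 0 of `heapTree`, at distance at most `k` from each node.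
-/
theorem statCost_le {n Δ k : ℕ} (σ : List (Request n)) (hΔ : 3 ≤ Δ) (hk : n ≤ 2 ^ k) :
    statCost Δ σ ≤ 2 * k := by
  refine (iInf_le _ ⟨heapTree n, fun v => (heapTree_degree n v).trans hΔ⟩).trans ?_
  rw [staticRouteCost]
  refine ENNReal.div_le_of_le_mul ?_
  have hd : ∀ r : Request n, (((heapTree n).edist r.1 r.2 : ℕ∞) : ℝ≥0∞) ≤ 2 * k := by
    intro r
    have hn : 0 < n := r.1.pos
    have h1 := heapTree_edist_zero hn k r.1 (r.1.2.trans_le hk)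
    have h2 := heapTree_edist_zero hn k r.2 (r.2.2.trans_le hk)
    rw [SimpleGraph.edist_comm] at h2
    have h3 : (heapTree n).edist r.1 r.2 ≤ ((2 * k : ℕ) : ℕ∞) := by
      refine SimpleGraph.edist_triangle.trans ((add_le_add h1 h2).trans ?_)
      push_cast; rw [two_mul]
    calc _ ≤ ((((2 * k : ℕ) : ℕ∞)) : ℝ≥0∞) := ENat.toENNReal_le.2 h3
      _ = 2 * k := by push_cast; rfl
  calc _ ≤ (σ.map fun r => ((heapTree n).edist r.1 r.2 : ℝ≥0∞)).length • (2 * (k : ℝ≥0∞)) :=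
        List.sum_le_card_nsmul _ _ (by
          rintro x hx
          obtain ⟨r, -, rfl⟩ := List.mem_map.1 hx
          exact hd r)
    _ = _ := by rw [List.length_map, nsmul_eq_mul, mul_comm]

/-! ### The demand -/

open Classical in
/-- The directed edges of the grid whose positions are named by `e`. -/
noncomputable def gridEdges {s n : ℕ} (e : Fin n ≃ Fin s × Fin s) : Finset (Request n) :=
  Finset.univ.filter fun p => (grid s).Adj (e p.1) (e p.2)

theorem mem_gridEdges {s n : ℕ} {e : Fin n ≃ Fin s × Fin s} {u v : Fin n} :
    (u, v) ∈ gridEdges e ↔ (grid s).Adj (e u) (e v) := by simp [gridEdges]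

theorem outDegree_gridEdges_le {s n : ℕ} (e : Fin n ≃ Fin s × Fin s) (u : Fin n) :
    ReNet.outDegree (gridEdges e) u ≤ 4 := by
  classical
  refine le_trans ?_ (grid_degree_le s (e u))
  rw [ReNet.outDegree, ← SimpleGraph.card_neighborFinset_eq_degree]
  refine Finset.card_le_card_of_injOn (fun p => e p.2) ?_ ?_
  · rintro ⟨a, b⟩ h
    obtain ⟨h1, rfl⟩ := Finset.mem_filter.1 h
    simpa [mem_gridEdges] using h1
  · rintro ⟨a, b⟩ h ⟨a', b'⟩ h' hb
    exact Prod.ext ((Finset.mem_filter.1 h).2.trans (Finset.mem_filter.1 h').2.symm)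
      (e.injective hb)

theorem le_card_gridEdges {s n : ℕ} (hn : n = s ^ 2) (e : Fin n ≃ Fin s × Fin s) :
    4 * n ≤ 4 * s + (gridEdges e).card := by
  classical
  have h := le_card_grid_adj s
  rw [← sq, ← hn] at h
  refine h.trans (Nat.add_le_add_left ?_ _)
  refine Finset.card_le_card_of_injOn (fun p => (e.symm p.1, e.symm p.2)) ?_ ?_
  · rintro ⟨x, y⟩ h
    simpa [mem_gridEdges] using h
  · rintro ⟨x, y⟩ _ ⟨x', y'⟩ _ h
    simpa using h

/-- The list in which every `p ∈ E` occurs `f p` times. -/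
noncomputable def repeatList {α : Type*} (E : Finset α) (f : α → ℕ) : List α :=
  E.toList.flatMap fun p => List.replicate (f p) p

theorem mem_repeatList {α : Type*} {E : Finset α} {f : α → ℕ} {p : α} :
    p ∈ repeatList E f ↔ p ∈ E ∧ f p ≠ 0 := by
  simp only [repeatList, List.mem_flatMap, Finset.mem_toList, List.mem_replicate]
  constructor
  · rintro ⟨a, h1, h2, rfl⟩; exact ⟨h1, h2⟩
  · rintro ⟨h1, h2⟩; exact ⟨p, h1, h2, rfl⟩

theorem length_repeatList {α : Type*} (E : Finset α) (f : α → ℕ) :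
    (repeatList E f).length = ∑ p ∈ E, f p := by
  simp [repeatList, List.length_flatMap]

theorem count_repeatList {α : Type*} [DecidableEq α] (E : Finset α) (f : α → ℕ) (p : α) :
    (repeatList E f).count p = if p ∈ E then f p else 0 := by
  rw [repeatList, List.count_flatMap]
  simp only [Function.comp_def, List.count_replicate, beq_iff_eq]
  rw [Finset.sum_map_toList, Finset.sum_ite_eq' E p]

/-- A uniform demand consisting of `n` long windows with different grids on which ReNet, with
threshold `32`, has constant cost. -/
theorem exists_grid_demand {s n D K : ℕ} (hs : Odd s) (h3 : 3 ≤ s) (hn : n = s ^ 2)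
    (hK : 8 * D + 1 ≤ K) :
    ∃ w : Fin n → List (Request n),
      (∀ i, IsGridDemand s (w i)) ∧ Function.Injective (fun i => demandEdges (w i)) ∧
      (∀ i, 8 * (n * K) ≤ (w i).length ∧ (w i).length ≤ 48 * (n * K)) ∧
      (∀ u v, (u, v) ∈ concatDemand w ↔ u ≠ v) ∧
      (∀ u v, u ≠ v → (concatDemand w).count (u, v) = 12 * K) ∧
      IsSparse 8 (8 * (n * K)) (concatDemand w) ∧
      (∀ i, ReNet.totalCost D 32 (demandBefore w i ++ w i) ≤
        ReNet.totalCost D 32 (demandBefore w i) + 7 * (w i).length) ∧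
      (concatDemand w).length ≤ ReNet.totalCost D 32 (concatDemand w) ∧
      ReNet.totalCost D 32 (concatDemand w) ≤ 7 * (concatDemand w).length := by
  classical
  obtain ⟨e, hcover, hfour, hinj, hdisj⟩ := exists_grid_family hs h3 hn
  set E : Fin n → Finset (Request n) := fun i => gridEdges (e i) with hE
  set m : Request n → ℕ := fun p => (Finset.univ.filter fun i => p ∈ E i).card with hm
  -- The factor 12 is divisible by each possible multiplicity 1, 2, 3, 4, so every pair gets exactly
  -- `12 * K` requests in total, with between `3 * K` and `12 * K` in each window containing it.
  set w : Fin n → List (Request n) := fun i => repeatList (E i) fun p => 12 * K / m p with hw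
  have hmE : ∀ u v i, (u, v) ∈ E i ↔ (grid s).Adj (e i u) (e i v) := fun u v i => mem_gridEdges
  have hm4 : ∀ p, m p ≤ 4 := by
    rintro ⟨u, v⟩
    exact hfour u v _ fun i hi => (hmE u v i).1 (Finset.mem_filter.1 hi).2
  have hm1 : ∀ p i, p ∈ E i → 1 ≤ m p := fun p i hp =>
    Finset.card_pos.2 ⟨i, Finset.mem_filter.2 ⟨Finset.mem_univ _, hp⟩⟩
  have hdiv : ∀ p, 1 ≤ m p → m p * (12 * K / m p) = 12 * K := by
    intro p hp
    refine Nat.mul_div_cancel' (Dvd.dvd.mul_right ?_ K)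
    have := hm4 p
    generalize m p = x at *
    interval_cases x <;> decide
  have hlow : ∀ p i, p ∈ E i → 3 * K ≤ 12 * K / m p := by
    intro p i hp
    rw [Nat.le_div_iff_mul_le (hm1 p i hp)]
    have := Nat.mul_le_mul_left (3 * K) (hm4 p)
    omega
  have hmem : ∀ i q, q ∈ w i ↔ q ∈ E i := by
    intro i q
    rw [hw, mem_repeatList]
    refine ⟨And.left, fun h => ⟨h, ?_⟩⟩
    have := hlow q i h
    omega
  have hedges : ∀ i, demandEdges (w i) = E i := by
    intro i; ext q; rw [demandEdges, List.mem_toFinset, hmem]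
  have hsym : ∀ i u v, (u, v) ∈ E i → (v, u) ∈ E i := fun i u v h =>
    (hmE v u i).2 ((hmE u v i).1 h).symm
  have hirr : ∀ i u v, (u, v) ∈ E i → u ≠ v := by
    rintro i u _ h rfl
    exact ((hmE u u i).1 h).ne rfl
  have hdeg : ∀ i u, ReNet.outDegree (E i) u ≤ 4 := fun i u => outDegree_gridEdges_le (e i) u
  have hcard : ∀ i, (E i).card ≤ 4 * n := fun i => ReNet.card_le_of_outDegree_le (hdeg i)
  have hcard' : ∀ i, 4 * n ≤ 4 * s + (E i).card := fun i => le_card_gridEdges hn (e i)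
  have hsn : 3 * s ≤ n := by rw [hn, sq]; exact Nat.mul_le_mul_right s h3
  have hlen : ∀ i, 8 * (n * K) ≤ (w i).length := by
    intro i
    rw [hw, length_repeatList]
    have h1 : (E i).card * (3 * K) ≤ ∑ p ∈ E i, 12 * K / m p := by
      rw [← smul_eq_mul]
      exact Finset.card_nsmul_le_sum _ _ _ fun p hp => hlow p i hp
    refine le_trans ?_ h1
    -- A grid has at least `4n - 4s` directed edges, and `3s ≤ n`.
    have h2 : 8 * n ≤ (E i).card * 3 := by
      have := hcard' i
      omega
    calc 8 * (n * K) = 8 * n * K := by ring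
      _ ≤ (E i).card * 3 * K := Nat.mul_le_mul_right _ h2
      _ = _ := by ring
  have hlen' : ∀ i, (w i).length ≤ 48 * (n * K) := by
    intro i
    rw [hw, length_repeatList]
    calc _ ≤ (E i).card • (12 * K) := Finset.sum_le_card_nsmul _ _ _ fun p _ => Nat.div_le_self _ _
      _ ≤ 4 * n * (12 * K) := Nat.mul_le_mul_right _ (hcard i)
      _ = _ := by ring
  have hcount : ∀ u v, u ≠ v → (concatDemand w).count (u, v) = 12 * K := by
    intro u v huv
    obtain ⟨i, hi⟩ := hcover u v huv
    rw [concatDemand, List.count_flatten, List.map_ofFn, List.sum_ofFn]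
    have h1 : ∀ j, (List.count (u, v) ∘ w) j = if (u, v) ∈ E j then 12 * K / m (u, v) else 0 := by
      intro j
      have := count_repeatList (E j) (fun p => 12 * K / m p) (u, v)
      rw [Function.comp_apply]
      convert this
    rw [Finset.sum_congr rfl fun j _ => h1 j, ← Finset.sum_filter, Finset.sum_const, smul_eq_mul]
    exact hdiv _ (hm1 _ i ((hmE u v i).2 hi))
  have hmemσ : ∀ u v, (u, v) ∈ concatDemand w ↔ u ≠ v := by
    intro u v
    simp only [concatDemand, List.mem_flatten, List.mem_ofFn]
    constructor
    · rintro ⟨_, ⟨i, rfl⟩, h⟩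
      exact hirr i u v ((hmem i _).1 h)
    · intro huv
      obtain ⟨i, hi⟩ := hcover u v huv
      exact ⟨_, ⟨i, rfl⟩, (hmem i _).2 ((hmE u v i).2 hi)⟩
  have hsat : 25 < n → ∀ (i j : ℕ) (K : Finset (Request n)), i < n → j + 6 ≤ i →
      (∀ m : Fin n, j < m → (m : ℕ) < i → E m ⊆ K) → 16 * n ≤ K.card := by
    intro hn25 i j K hi hj hsub
    have h7 : 7 ≤ s := by
      obtain ⟨r, hr⟩ := hs
      by_contra hc
      have : s ≤ 5 := by omega
      have : n ≤ 25 := by rw [hn]; exact Nat.pow_le_pow_left this 2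
      omega
    -- Five windows with at least `4n - 4s` edges each, pairwise disjoint as their indices differ by
    -- at most 4; since `7s ≤ n`, their union has at least `120n/7 ≥ 16n` edges.
    let x : Fin 5 → Fin n := fun t => ⟨j + 1 + t, by omega⟩
    have hpd : (↑(Finset.univ : Finset (Fin 5)) : Set (Fin 5)).PairwiseDisjoint
        fun t => E (x t) := by
      have key : ∀ a b : Fin 5, a < b → Disjoint (E (x a)) (E (x b)) := by
        intro a b hab
        rw [Finset.disjoint_left]
        rintro ⟨u, v⟩ hu hv
        refine hdisj h7 (x a) (x b) ?_ ?_ u v ((hmE _ _ _).1 hu) ((hmE _ _ _).1 hv)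
        · rw [Fin.lt_def] at hab ⊢
          simp only [x]; omega
        · simp only [x]; omega
      intro a _ b _ hab
      rcases lt_or_gt_of_ne hab with h | h
      · exact key a b h
      · exact (key b a h).symm
    have h1 : (Finset.univ.biUnion fun t => E (x t)) ⊆ K := by
      refine Finset.biUnion_subset.2 fun t _ => hsub _ ?_ ?_ <;> simp only [x] <;> omega
    have h2 := Finset.card_le_card h1
    rw [Finset.card_biUnion hpd] at h2
    have h3 : ∑ _t : Fin 5, (4 * n - 4 * s) ≤ ∑ t : Fin 5, (E (x t)).card :=
      Finset.sum_le_sum fun t _ => by have := hcard' (x t); omega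
    rw [Finset.sum_const, Finset.card_univ, Fintype.card_fin, smul_eq_mul] at h3
    have h4 : 7 * s ≤ n := by rw [hn, sq]; exact Nat.mul_le_mul_right s h7
    omega
  -- Six window lengths amount to at least `48n(8D + 1)`, more than the overhead `24nD + 45n + 3D +
  -- 2`.
  obtain ⟨r1, r2, r3⟩ := ReNet.run_windows (D := D) hsym hirr hdeg hsat hmem (by
    intro i
    have h1 := hlen i
    have h2 : n * (8 * D + 1) ≤ n * K := Nat.mul_le_mul_left n hK
    have h3 : D ≤ n * D := Nat.le_mul_of_pos_left D (by omega)
    have h4 : (3 * D + 2) * (8 * n + 1) = 24 * (n * D) + 16 * n + 3 * D + 2 := by ring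
    have h5 : n * (8 * D + 1) = 8 * (n * D) + n := by ring
    omega)
  refine ⟨w, fun i => ⟨e i, fun u v => by rw [hedges, hmE]⟩, ?_, fun i => ⟨hlen i, hlen' i⟩, hmemσ,
    hcount, isSparse_concatDemand hlen fun i => ?_, r1, r2, r3⟩
  · intro i j hij
    simp only [hedges] at hij
    exact hinj i j fun u v => by rw [← hmE, ← hmE, hij]
  · rw [hedges]
    have := hcard i
    omega

/-! ### Numerical estimates and the main theorem -/

/-- The finitely many `n` below the asymptotic range are absorbed by adding all their values of `D`
to the constant; the main theorem needs one constant for every `s ≥ 3`. -/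
theorem exists_bound_of_isBigO_log {D : ℕ → ℕ}
    (hD : (fun n => (D n : ℝ)) =O[atTop] fun n : ℕ => Real.log n) :
    ∃ C : ℝ, 0 ≤ C ∧ ∀ n : ℕ, 1 ≤ Real.log n → (D n : ℝ) ≤ C * Real.log n := by
  obtain ⟨C, hC, hb⟩ := hD.exists_nonneg
  obtain ⟨N, hN⟩ := eventually_atTop.1 hb.bound
  refine ⟨C + ∑ k ∈ Finset.range N, (D k : ℝ), by positivity, fun n hn => ?_⟩
  have hsum : (0 : ℝ) ≤ ∑ k ∈ Finset.range N, (D k : ℝ) := by positivity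
  rcases lt_or_ge n N with h | h
  · have h1 : (D n : ℝ) ≤ ∑ k ∈ Finset.range N, (D k : ℝ) :=
      Finset.single_le_sum (f := fun k => (D k : ℝ)) (fun k _ => by positivity)
        (Finset.mem_range.2 h)
    nlinarith
  · have h1 := hN n h
    rw [Real.norm_of_nonneg (by positivity), Real.norm_of_nonneg (by linarith)] at h1
    nlinarith

theorem one_le_log_of_nine_le {n : ℕ} (hn : 9 ≤ n) : 1 ≤ Real.log n := by
  rw [Real.le_log_iff_exp_le (by positivity)]
  have h1 : (9 : ℝ) ≤ n := by exact_mod_cast hn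
  linarith [Real.exp_one_lt_d9]

theorem log_le_natLog_two_add_one {n : ℕ} (hn : 0 < n) :
    Real.log n ≤ (Nat.log 2 n + 1 : ℕ) := by
  have h1 : (n : ℝ) ≤ 2 ^ (Nat.log 2 n + 1) := by
    exact_mod_cast (Nat.lt_pow_succ_log_self one_lt_two n).le
  have h2 := Real.log_le_log (by positivity) h1
  rw [Real.log_pow] at h2
  nlinarith [Real.log_two_lt_d9, Real.log_two_gt_d9]

theorem natLog_two_add_one_le {n : ℕ} (hn : 9 ≤ n) :
    ((Nat.log 2 n + 1 : ℕ) : ℝ) ≤ 3 * Real.log n := by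
  have h0 := one_le_log_of_nine_le hn
  have h1 : (2 : ℝ) ^ Nat.log 2 n ≤ n := by exact_mod_cast Nat.pow_log_le_self 2 (by omega)
  have h2 := Real.log_le_log (by positivity) h1
  rw [Real.log_pow] at h2
  have h3 : (0 : ℝ) ≤ Nat.log 2 n := by positivity
  push_cast
  nlinarith [Real.log_two_gt_d9]

/-- The base is `193 = Δ + 1` for `Δ = 192`. The crude bounds `log 193 ≤ 192` and `log 2 < 1`
suffice for the factor 384. -/
theorem log_le_natLog_half {n : ℕ} (hn : 9 ≤ n) :
    Real.log n ≤ 384 * ((Nat.log 193 (n / 2) : ℝ) + 1) := by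
  set k := Nat.log 193 (n / 2)
  have h1 : n ≤ 2 * 193 ^ (k + 1) := by
    have : n / 2 < 193 ^ (k + 1) := Nat.lt_pow_succ_log_self (by norm_num) _
    omega
  have h2 : (n : ℝ) ≤ 2 * 193 ^ (k + 1) := by exact_mod_cast h1
  have hn0 : (0 : ℝ) < n := by positivity
  have h3 := Real.log_le_log hn0 h2
  rw [Real.log_mul (by norm_num) (by positivity), Real.log_pow] at h3
  push_cast at h3
  have h4 := Real.log_le_sub_one_of_pos (show (0 : ℝ) < 193 by norm_num)
  have h5 : (0 : ℝ) ≤ k := by positivity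
  nlinarith [Real.log_two_lt_d9]

theorem mainTheorem3 :
    ∃ c : ℕ, 0 < c ∧
      ∀ D : ℕ → ℕ, (fun n => (D n : ℝ)) =Θ[atTop] (fun n : ℕ => Real.log n) →
        ∃ a b : ℝ, 0 < a ∧ 0 < b ∧
          ∀ s n : ℕ, Odd s → 3 ≤ s → n = s ^ 2 →
            ∃ w : Fin n → List (Request n),
              -- `n` windows of length `Θ(n log n)` with pairwise different grid demand graphs
              (∀ i, IsGridDemand s (w i)) ∧
              Function.Injective (fun i => demandEdges (w i)) ∧
              (∀ i, a * (n * Real.log n) ≤ ((w i).length : ℝ) ∧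
                ((w i).length : ℝ) ≤ b * (n * Real.log n)) ∧
              -- the whole demand is uniform, and sparse at the scale `δ ≥ c n D`
              IsUniformDemand (concatDemand w) ∧
              (∃ δ : ℕ, c * n * D n ≤ δ ∧ a * (n * Real.log n) ≤ (δ : ℝ) ∧
                δ ≤ (concatDemand w).length ∧ IsSparse c δ (concatDemand w)) ∧
              -- ReNet pays constant cost per request, in each window and overall
              (∀ i, (ReNet.totalCost (D n) (4 * c) (demandBefore w i ++ w i) : ℝ) ≤
                ReNet.totalCost (D n) (4 * c) (demandBefore w i) + b * (w i).length) ∧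
              ReNet.avgCost (D n) (4 * c) (concatDemand w) ≤ ENNReal.ofReal b ∧
              -- the optimal static network pays `Θ(log n)` per request
              ENNReal.ofReal (a * Real.log n) ≤ statCost (24 * c) (concatDemand w) ∧
              statCost (24 * c) (concatDemand w) ≤ ENNReal.ofReal (b * Real.log n) ∧
              -- the two costs differ by a factor `Θ(log n)`
              ENNReal.ofReal (a * Real.log n) *
                  ReNet.avgCost (D n) (4 * c) (concatDemand w) ≤
                statCost (24 * c) (concatDemand w) ∧
              statCost (24 * c) (concatDemand w) ≤
                ENNReal.ofReal (b * Real.log n) *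
                  ReNet.avgCost (D n) (4 * c) (concatDemand w) := by
  refine ⟨8, by norm_num, fun D hD => ?_⟩
  obtain ⟨C, hC, hDC⟩ := exists_bound_of_isBigO_log hD.1
  -- ReNet costs at most 7 and the static network at least `log n / 768`, and `7 · 768 ≤ 6000`. The
  -- upper constant comes from the window length `48nK` with `K ≤ (8C + 3) log n`.
  refine ⟨1 / 6000, 48 * (8 * C + 3), by norm_num, by positivity, fun s n hs h3 hn => ?_⟩
  have hn9 : 9 ≤ n := by rw [hn]; exact Nat.pow_le_pow_left h3 2
  have hlog := one_le_log_of_nine_le hn9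
  set ℓ := Nat.log 2 n + 1 with hℓ
  have hℓ1 : Real.log n ≤ ℓ := log_le_natLog_two_add_one (by omega)
  have hℓ2 : (ℓ : ℝ) ≤ 3 * Real.log n := natLog_two_add_one_le hn9
  -- The term `8 * D n` pays for the coordinator and gives `δ ≥ c n D`; the term `ℓ` guarantees
  -- length of order `n log n` however small `D n` is.
  set K := 8 * D n + ℓ with hKdef
  have hK1 : Real.log n ≤ K := hℓ1.trans (by exact_mod_cast Nat.le_add_left _ _)
  have hK2 : (K : ℝ) ≤ (8 * C + 3) * Real.log n := by
    have := hDC n hlog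
    rw [hKdef]; push_cast
    linarith
  have hn0 : (0 : ℝ) ≤ n := by positivity
  have hnK1 : (n : ℝ) * Real.log n ≤ n * K := mul_le_mul_of_nonneg_left hK1 hn0
  have hnK2 : (n : ℝ) * K ≤ n * ((8 * C + 3) * Real.log n) := mul_le_mul_of_nonneg_left hK2 hn0
  have hnl : 0 ≤ (n : ℝ) * Real.log n := by positivity
  obtain ⟨w, h1, h2, hlen, hmem, hcount, hsparse, hwin, hcost1, hcost2⟩ :=
    exists_grid_demand (D := D n) (K := K) hs h3 hn (by omega)
  set σ := concatDemand w with hσ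
  have hδσ : 8 * (n * K) ≤ σ.length := by
    have hsub : (w ⟨0, by omega⟩).Sublist σ :=
      List.sublist_flatten_of_mem (List.mem_ofFn.2 ⟨_, rfl⟩)
    exact (hlen _).1.trans hsub.length_le
  have hpos : 0 < σ.length := by
    have : 0 < 8 * (n * K) := by
      have : 0 < K := by omega
      positivity
    omega
  have hσ0 : (σ.length : ℝ≥0∞) ≠ 0 := by exact_mod_cast hpos.ne'
  have havg1 : 1 ≤ ReNet.avgCost (D n) 32 σ := by
    rw [ReNet.avgCost, ENNReal.le_div_iff_mul_le (.inl hσ0) (.inl (ENNReal.natCast_ne_top _)),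
      one_mul]
    exact_mod_cast hcost1
  have havg2 : ReNet.avgCost (D n) 32 σ ≤ 7 := by
    refine ENNReal.div_le_of_le_mul ?_
    exact_mod_cast hcost2
  have hstat1 : ENNReal.ofReal (1 / 768 * Real.log n) ≤ statCost 192 σ := by
    have hk : 2 * (192 + 1) ^ Nat.log 193 (n / 2) ≤ n := by
      have := Nat.pow_log_le_self 193 (x := n / 2) (by omega)
      norm_num at this ⊢
      omega
    refine le_trans ?_ (le_statCost hmem hcount hk (List.ne_nil_of_length_pos hpos))
    have h := log_le_natLog_half hn9
    calc ENNReal.ofReal (1 / 768 * Real.log n)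
        ≤ ENNReal.ofReal (((Nat.log 193 (n / 2) + 1 : ℕ) : ℝ) / 2) := by
          apply ENNReal.ofReal_le_ofReal
          push_cast
          linarith
      _ = _ := by
          rw [ENNReal.ofReal_div_of_pos (by norm_num), ENNReal.ofReal_natCast,
            ENNReal.ofReal_ofNat]
          push_cast; rfl
  have hstat2 : statCost 192 σ ≤ ENNReal.ofReal (6 * Real.log n) := by
    refine (statCost_le (k := ℓ) σ (by norm_num)
      (Nat.lt_pow_succ_log_self one_lt_two n).le).trans ?_
    calc (2 : ℝ≥0∞) * ℓ = ENNReal.ofReal (2 * ℓ) := by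
          rw [ENNReal.ofReal_mul (by norm_num), ENNReal.ofReal_ofNat, ENNReal.ofReal_natCast]
      _ ≤ _ := ENNReal.ofReal_le_ofReal (by linarith)
  have hstat3 : statCost 192 σ ≤ ENNReal.ofReal (48 * (8 * C + 3) * Real.log n) :=
    hstat2.trans (ENNReal.ofReal_le_ofReal (by nlinarith))
  refine ⟨w, h1, h2, fun i => ?_, ⟨hmem, fun u v u' v' h h' => ?_⟩,
    ⟨8 * (n * K), ?_, ?_, hδσ, hsparse⟩, fun i => ?_, ?_, ?_, hstat3, ?_, ?_⟩
  · obtain ⟨g1, g2⟩ := hlen i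
    have g1' : (8 * (n * K) : ℝ) ≤ (w i).length := by exact_mod_cast g1
    have g2' : ((w i).length : ℝ) ≤ 48 * (n * K) := by exact_mod_cast g2
    constructor <;> linarith
  · rw [hcount u v h, hcount u' v' h']
  · have : n * (8 * D n) ≤ 8 * (n * K) := by
      have : n * (8 * D n) ≤ n * K := Nat.mul_le_mul_left _ (Nat.le_add_right _ _)
      omega
    calc 8 * n * D n = n * (8 * D n) := by ring
      _ ≤ _ := this
  · push_cast
    linarith
  · have h := hwin i
    have h' : (ReNet.totalCost (D n) 32 (demandBefore w i ++ w i) : ℝ) ≤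
        ReNet.totalCost (D n) 32 (demandBefore w i) + 7 * (w i).length := by exact_mod_cast h
    have hl : (0 : ℝ) ≤ (w i).length := by positivity
    refine h'.trans ?_
    nlinarith
  · refine havg2.trans ?_
    rw [show (7 : ℝ≥0∞) = ENNReal.ofReal 7 by simp]
    exact ENNReal.ofReal_le_ofReal (by linarith)
  · exact (ENNReal.ofReal_le_ofReal (by linarith)).trans hstat1
  · refine le_trans ?_ hstat1
    calc ENNReal.ofReal (1 / 6000 * Real.log n) * ReNet.avgCost (D n) 32 σ
        ≤ ENNReal.ofReal (1 / 6000 * Real.log n) * ENNReal.ofReal 7 := by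
          gcongr
          simpa using havg2
      _ = ENNReal.ofReal (1 / 6000 * Real.log n * 7) := (ENNReal.ofReal_mul (by positivity)).symm
      _ ≤ _ := ENNReal.ofReal_le_ofReal (by linarith)
  · exact hstat3.trans (le_mul_of_one_le_right zero_le havg1)
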